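/- **Setting.** Let $\mathcal V,\mathcal Q,\mathcal H_{\mathcal Q}$ be real Hilbert spaces with a Gelfand triple $\mathcal Q\hookrightarrow\mathcal H_{\mathcal Q}\simeq\mathcal H_{\mathcal Q}^*\hookrightarrow\mathcal Q^*$ (continuous dense embedding); for Biot poroelasticity $\mathcal V=[H^1_0(\Omega)]^m$, $\mathcal Q=H^1_0(\Omega)$, $\mathcal H_{\mathcal Q}=L^2(\Omega)$. Let $a,b,c$ be symmetric, continuous, elliptic bilinear forms on $\mathcal V,\mathcal Q,\mathcal H_{\mathcal Q}$ with ellipticity constants $c_a,c_b,c_c>0$, and let $d$ be a bounded bilinear form on $\mathcal V\times\mathcal H_{\mathcal Q}$. Given $f:[0,T]\to\mathcal V^*$ and $g:[0,T]\to\mathcal Q^*$, $0<T<\infty$, the elliptic–parabolic problem is $$a(u,v)-d(v,p)=\langle f,v\rangle,\qquad d(\dot u,q)+c(\dot p,q)+b(p,q)=\langle g,q\rangle\qquad\text{for all }v\in\mathcal V,\ q\in\mathcal Q\text{ and a.e. }t\in[0,T].$$ **Scheme.** Let $k\in\{1,\dots,5\}$, let $\xi_0,\dots,\xi_k$ be given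 by $\sum_{\ell=0}^k\xi_\ell s^\ell=\sum_{\ell=1}^k\frac1\ell(1-s)^\ell$, let $L>0$ be a stabilization parameter, $\tau>0$ a step size, $t^n=n\tau$, and $\mathrm{tol}>0$. Starting values $(u^\ell,p^\ell)\in\mathcal V\times\mathcal H_{\mathcal Q}$, $\ell<k$, are given, consistent in the sense that $a(u^\ell,v)-d(v,p^\ell)=\langle f(t^\ell),v\rangle$ for all $v\in\mathcal V$; for $\ell<k$ write $y^{\ell,J_\ell}:=y^\ell$, $y\in\{u,p\}$. For $n\ge k$, starting from an arbitrary initial guess $(u^{n,0},p^{n,0})\in\mathcal V\times\mathcal H_{\mathcal Q}$, the iterates $(u^{n,i},p^{n,i})\in\mathcal V\times\mathcal Q$, $1\le i\le J_n$, satisfy for all $v\in\mathcal V$, $q\in\mathcal Q$ $$a(u^{n,i},v)-d(v,p^{n,i})=\langle f(t^n),v\rangle,$$ $$d(\partial_k u^{n,i-1},q)+c(\partial_k p^{n,i},q)+b(p^{n,i},q)+L\,(\partial_k p^{n,i}-\partial_k p^{n,i-1},q)_{\mathcal H_{\mathcal Q}}=\langle g(t^n),q\rangle,$$ where $\partial_k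 y^{n,i}:=\frac1\tau\big(\xi_0y^{n,i}+\sum_{\ell=1}^k\xi_\ell y^{n-\ell,J_{n-\ell}}\big)$. Here $J_n$ is the smallest $i\ge1$ with $p^{n,i}-p^{n,i-1}\in\mathcal Q$ and $$\tfrac{c_a}{2}\|u^{n,i}-u^{n,i-1}\|_{\mathcal V}^2+\big(c_c+\tfrac L2\big)\|p^{n,i}-p^{n,i-1}\|_{\mathcal H_{\mathcal Q}}^2+\tfrac{\tau}{\xi_0}c_b\|p^{n,i}-p^{n,i-1}\|_{\mathcal Q}^2\le\mathrm{tol}^2$$ (it is presupposed that the iteration terminates). **Theorem.** There are constants $C,K>0$, depending only on the spaces, the bilinear forms and their constants, $k$ and $L$, such that the following holds. Let $u\in\mathcal C^k([0,T],\mathcal V)$, $p\in\mathcal C^k([0,T],\mathcal H_{\mathcal Q})$ solve the elliptic–parabolic problem with $f\in\mathcal C^{k+1}([0,T],\mathcal V^*)$, $g\in\mathcal C^k([0,T],\mathcal Q^*)$. Then there is $R>0$, depending in addition only on $T,f,g,u,p$ (in particular not on $\tau$, $\mathrm{tol}$, $n$, the starting values, the initial guesses or the iteration numbers), such that for every run of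 the scheme and all $n\ge k$ with $t^n\le T$, $$\|u^{n,J_n}-u(t^n)\|_{\mathcal V}^2+\|p^{n,J_n}-p(t^n)\|_{\mathcal H_{\mathcal Q}}^2\le e^{Ct^n}\Big(K\,\frac{\mathrm{tol}^2}{\tau^3}+R\,\tau^{2k}+K\sum_{\ell=0}^{k-1}\|p^\ell-p(t^\ell)\|_{\mathcal H_{\mathcal Q}}^2\Big).$$ -/

import Mathlib

open Set MeasureTheory
open scoped InnerProductSpace

noncomputable section

/-- The data of an abstract linear elliptic–parabolic problem. `V`, `Q`, `H` are real Hilbert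
spaces, `ι : Q → H` is the dense continuous embedding of the Gelfand triple `Q ↪ H ≃ H* ↪ Q*`;
`a`, `b`, `c` are symmetric, continuous, elliptic bilinear forms on `V`, `Q`, `H` with
ellipticity constants `ca`, `cb`, `cc`, and `d` is a bounded bilinear form on `V × H`.
(For Biot poroelasticity: `V = [H¹₀(Ω)]ᵐ`, `Q = H¹₀(Ω)`, `H = L²(Ω)`.) -/
structure EllipticParabolicData (V Q H : Type*)
    [NormedAddCommGroup V] [InnerProductSpace ℝ V]
    [NormedAddCommGroup Q] [InnerProductSpace ℝ Q]
    [NormedAddCommGroup H] [InnerProductSpace ℝ H] where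
  ι : Q →L[ℝ] H
  ι_injective : Function.Injective ι
  ι_denseRange : DenseRange ι
  a : V →L[ℝ] V →L[ℝ] ℝ
  b : Q →L[ℝ] Q →L[ℝ] ℝ
  c : H →L[ℝ] H →L[ℝ] ℝ
  d : V →L[ℝ] H →L[ℝ] ℝ
  ca : ℝ
  cb : ℝ
  cc : ℝ
  ca_pos : 0 < ca
  cb_pos : 0 < cb
  cc_pos : 0 < cc
  a_symm : ∀ v w, a v w = a w v
  b_symm : ∀ q r, b q r = b r q
  c_symm : ∀ q r, c q r = c r q
  a_elliptic : ∀ v, ca * ‖v‖ ^ 2 ≤ a v v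
  b_elliptic : ∀ q, cb * ‖q‖ ^ 2 ≤ b q q
  c_elliptic : ∀ q, cc * ‖q‖ ^ 2 ≤ c q q

/-- The polynomial `ξ(s) = ∑_{ℓ=1}^k (1/ℓ) (1 - s)^ℓ` generating the BDF-`k` coefficients. -/
def bdfPoly (k : ℕ) : Polynomial ℝ :=
  ∑ ℓ ∈ Finset.Icc 1 k, Polynomial.C ((1 : ℝ) / (ℓ : ℝ)) * (1 - Polynomial.X) ^ ℓ

/-- The BDF-`k` coefficient `ξ_ℓ`. -/
def bdfCoeff (k ℓ : ℕ) : ℝ := (bdfPoly k).coeff ℓ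

/-- The values `y^{n,J_n}` accepted at the time points: the starting values for `n < k`, and the
last inner iterate for `n ≥ k`. -/
def accepted {X : Type*} (k : ℕ) (y₀ : ℕ → X) (y : ℕ → ℕ → X) (J : ℕ → ℕ) (n : ℕ) : X :=
  if n < k then y₀ n else y n (J n)

/-- The BDF-`k` operator applied to an inner iterate,
`(1/τ) (ξ₀ y^{n,i} + ∑_{ℓ=1}^k ξ_ℓ y^{n-ℓ,J_{n-ℓ}})`, used for `n ≥ k`. -/
def bdfIter {X : Type*} [AddCommGroup X] [Module ℝ X] (k : ℕ) (τ : ℝ)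
    (y₀ : ℕ → X) (y : ℕ → ℕ → X) (J : ℕ → ℕ) (n i : ℕ) : X :=
  (1 / τ) • (bdfCoeff k 0 • y n i +
    ∑ ℓ ∈ Finset.Icc 1 k, bdfCoeff k ℓ • accepted k y₀ y J (n - ℓ))

namespace EllipticParabolicData

variable {V Q H : Type*}
  [NormedAddCommGroup V] [InnerProductSpace ℝ V]
  [NormedAddCommGroup Q] [InnerProductSpace ℝ Q]
  [NormedAddCommGroup H] [InnerProductSpace ℝ H]

/-- `(u, p)` solves the elliptic–parabolic problem on `[0, T]`: for a.e. `t ∈ [0, T]`,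
`a(u, v) - d(v, p) = ⟨f, v⟩` for all `v ∈ V`, and `p(t) ∈ Q` with
`d(u', q) + c(p', q) + b(p, q) = ⟨g, q⟩` for all `q ∈ Q`. -/
def IsSolution (S : EllipticParabolicData V Q H) (T : ℝ)
    (f : ℝ → V →L[ℝ] ℝ) (g : ℝ → Q →L[ℝ] ℝ) (u : ℝ → V) (p : ℝ → H) : Prop :=
  ∀ᵐ t ∂(volume.restrict (Icc (0 : ℝ) T)),
    (∀ v : V, S.a (u t) v - S.d v (p t) = f t v) ∧
    ∃ pQ : Q, S.ι pQ = p t ∧ ∀ q : Q,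
      S.d (derivWithin u (Icc 0 T) t) (S.ι q) + S.c (derivWithin p (Icc 0 T) t) (S.ι q)
        + S.b pQ q = g t q

/-- The termination criterion for two consecutive inner iterates `(u', p')`, `(u, p)`:
the increment `p - p'` lies in `Q` and
`(ca/2) ‖u - u'‖_V² + (cc + L/2) ‖p - p'‖_H² + (τ/ξ₀) cb ‖p - p'‖_Q² ≤ tol²`. -/
def StopCriterion (S : EllipticParabolicData V Q H) (k : ℕ) (L τ tol : ℝ)
    (u' u : V) (p' p : H) : Prop :=
  ∃ δ : Q, S.ι δ = p - p' ∧
    S.ca / 2 * ‖u - u'‖ ^ 2 + (S.cc + L / 2) * ‖p - p'‖ ^ 2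
      + τ / bdfCoeff k 0 * S.cb * ‖δ‖ ^ 2 ≤ tol ^ 2

/-- `(u^{n,i}, p^{n,i})`, with iteration numbers `J_n`, is a run of the fixed-stress iteration
combined with BDF-`k` on the grid `t^n = n τ`, `n ≤ N`, with starting values `(u₀^ℓ, p₀^ℓ)`,
`ℓ < k`, stabilization parameter `L` and tolerance `tol`. The initial guesses
`(u^{n,0}, p^{n,0}) ∈ V × H` are arbitrary. -/
structure IsFixedStressBDF (S : EllipticParabolicData V Q H) (k : ℕ) (L τ tol : ℝ)
    (f : ℝ → V →L[ℝ] ℝ) (g : ℝ → Q →L[ℝ] ℝ) (N : ℕ) (u₀ : ℕ → V) (p₀ : ℕ → H)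
    (u : ℕ → ℕ → V) (p : ℕ → ℕ → H) (J : ℕ → ℕ) : Prop where
  /-- The starting values are consistent with the elliptic equation. -/
  consistent : ∀ ℓ < k, ∀ v : V, S.a (u₀ ℓ) v - S.d v (p₀ ℓ) = f (ℓ * τ) v
  /-- The elliptic equation holds for every inner iterate. -/
  elliptic : ∀ n, k ≤ n → n ≤ N → ∀ i, 1 ≤ i → i ≤ J n → ∀ v : V,
    S.a (u n i) v - S.d v (p n i) = f (n * τ) v
  /-- The stabilized parabolic equation holds for every inner iterate. -/
  parabolic : ∀ n, k ≤ n → n ≤ N → ∀ i, 1 ≤ i → i ≤ J n →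
    ∃ pQ : Q, S.ι pQ = p n i ∧ ∀ q : Q,
      S.d (bdfIter k τ u₀ u J n (i - 1)) (S.ι q) + S.c (bdfIter k τ p₀ p J n i) (S.ι q)
        + S.b pQ q
        + L * ⟪bdfIter k τ p₀ p J n i - bdfIter k τ p₀ p J n (i - 1), S.ι q⟫_ℝ
        = g (n * τ) q
  /-- `J n` is the first index at which the termination criterion is met. -/
  termination : ∀ n, k ≤ n → n ≤ N →
    IsLeast {i : ℕ | 1 ≤ i ∧
      S.StopCriterion k L τ tol (u n (i - 1)) (u n i) (p n (i - 1)) (p n i)} (J n)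

end EllipticParabolicData

end

/-! Neither the contraction of the inner iteration nor a Gronwall argument enters. The accepted
values satisfy the fully implicit BDF-`k` equations up to a residual, and the estimate is
consistency plus stability for that perturbed scheme.

Elimination of `u`: the elliptic equation gives `u = D p + R f` with bounded `D`, `R`. It holds for
the exact solution and, by consistency of the starting values, for every accepted value, so the
errors satisfy `e_u = D e_p`. What remains is a parabolic error equation for `e_p` with the form `M
= c + d(D ·, ·)`, which is symmetric and elliptic because `d(D x, y) = a(D y, D x)`.

Residual: replacing the lagged `u^{n,i-1}` by `u^{n,i}` and dropping the stabilization costs `ξ₀/τ`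
times the last increments, which the stopping criterion bounds by a multiple of `tol/τ` in the dual
of `Q`.

Stability (`bdf_stability`): testing with `eⁿ - (9/10) eⁿ⁻¹` makes the `M`-part dominate the
increment of a quadratic energy (`exists_bdf_energy`), while the `b`-part telescopes. The constant
is independent of `T` and `τ`.

Consistency: order `τ^{2k}` asks for `k + 1` derivatives of `y = d(u, ·) + c(p, ·)` in the dual of
`Q`, one more than is assumed. Parabolic regularity supplies the missing one in `L²`: difference
quotients of the `(k-1)`-st derivative of the pressure are bounded in `L²(Q)`, and the equation
transfers this to `y`. It is expressed as `‖y⁽ᵏ⁾(t) - y⁽ᵏ⁾(s)‖² ≤ (t - s)(F t - F s)` with `F`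
monotone and bounded (`exists_increment_bound`), which is enough to sum the squared truncation
errors.

Finally the accumulated residual is at most a multiple of `(tⁿ)² tol²/τ³`, and `(tⁿ)² ≤ exp (2 tⁿ)`
is the only source of the exponential. -/

/-! ### Multiplier certificates for BDF-1 to BDF-5. -/

/-- Expanded square of a combination of six values, the maximum needed for `k ≤ 5`. Written in the
entries `M (x i) (x j)`, it makes sum-of-squares certificates linear and hence accessible to
`linarith`. -/
theorem quadratic_form_nonneg {H : Type*} [NormedAddCommGroup H] [InnerProductSpace ℝ H]
    (M : H →L[ℝ] H →L[ℝ] ℝ) (hM : ∀ x y, M x y = M y x) (hM0 : ∀ x, 0 ≤ M x x)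
    (x : ℕ → H) (c0 c1 c2 c3 c4 c5 : ℝ) :
    0 ≤ c0 ^ 2 * M (x 0) (x 0) +
      2 * c0 * c1 * M (x 0) (x 1) +
      2 * c0 * c2 * M (x 0) (x 2) +
      2 * c0 * c3 * M (x 0) (x 3) +
      2 * c0 * c4 * M (x 0) (x 4) +
      2 * c0 * c5 * M (x 0) (x 5) +
      c1 ^ 2 * M (x 1) (x 1) +
      2 * c1 * c2 * M (x 1) (x 2) +
      2 * c1 * c3 * M (x 1) (x 3) +
      2 * c1 * c4 * M (x 1) (x 4) +
      2 * c1 * c5 * M (x 1) (x 5) +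
      c2 ^ 2 * M (x 2) (x 2) +
      2 * c2 * c3 * M (x 2) (x 3) +
      2 * c2 * c4 * M (x 2) (x 4) +
      2 * c2 * c5 * M (x 2) (x 5) +
      c3 ^ 2 * M (x 3) (x 3) +
      2 * c3 * c4 * M (x 3) (x 4) +
      2 * c3 * c5 * M (x 3) (x 5) +
      c4 ^ 2 * M (x 4) (x 4) +
      2 * c4 * c5 * M (x 4) (x 5) +
      c5 ^ 2 * M (x 5) (x 5) := by
  have h := hM0 (c0 • x 0 + c1 • x 1 + c2 • x 2 + c3 • x 3 + c4 • x 4 + c5 • x 5)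
  simp only [map_add, map_smul, add_apply, smul_apply,
    smul_eq_mul, hM (x 1) (x 0), hM (x 2) (x 0), hM (x 3) (x 0), hM (x 4) (x 0), hM (x 5) (x 0), hM (x 2) (x 1), hM (x 3) (x 1), hM (x 4) (x 1), hM (x 5) (x 1), hM (x 3) (x 2), hM (x 4) (x 2), hM (x 5) (x 2), hM (x 4) (x 3), hM (x 5) (x 3), hM (x 5) (x 4)] at h
  linarith

theorem bdfPoly_1 : bdfPoly 1 =
    Polynomial.C 1 * Polynomial.X ^ 0 + Polynomial.C (-1) * Polynomial.X ^ 1 := by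
  refine Polynomial.funext fun r => ?_
  simp [bdfPoly]
  ring

/-- For each `k` the three inequalities assert nonnegativity of explicit quadratic forms in finitely
many values, certified by rational sums of squares. The parameter `9/10` serves all `k ≤ 5`; being
below `1`, it leaves the slack in the `b`-terms used by `bdf_energy_step`. -/
theorem exists_bdf_energy_1 {H : Type*} [NormedAddCommGroup H] [InnerProductSpace ℝ H]
    (M : H →L[ℝ] H →L[ℝ] ℝ) (hM : ∀ x y, M x y = M y x) (hM0 : ∀ x, 0 ≤ M x x) :
    ∃ (E : (ℕ → H) → ℝ) (γ Γ : ℝ), 0 < γ ∧ 0 < Γ ∧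
      (∀ x, γ * M (x 0) (x 0) ≤ E x) ∧
      (∀ x, E x ≤ Γ * ∑ i ∈ Finset.range 1, M (x i) (x i)) ∧
      ∀ x, E x - E (fun i => x (i + 1)) ≤
        M (∑ ℓ ∈ Finset.range (1 + 1), bdfCoeff 1 ℓ • x ℓ) (x 0 - (9 / 10 : ℝ) • x 1) := by
  refine ⟨fun x => (1/20) * M (x 0) (x 0), (1/20), 1, by norm_num, by norm_num,
    fun x => ?_, fun x => ?_, fun x => ?_⟩
  · have h := quadratic_form_nonneg M hM hM0 x
    linarith [mul_nonneg (by norm_num : (0 : ℝ) ≤ 0) (h 1 0 0 0 0 0)]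
  · have h := quadratic_form_nonneg M hM hM0 x
    simp only [Finset.sum_range_succ, Finset.sum_range_zero]
    linarith [mul_nonneg (by norm_num : (0 : ℝ) ≤ (19/20)) (h 1 0 0 0 0 0)]
  · have h := quadratic_form_nonneg M hM hM0 x
    have hc : bdfCoeff 1 0 = 1 ∧ bdfCoeff 1 1 = (-1) := by
      refine ⟨?_, ?_⟩ <;>
        simp [bdfCoeff, bdfPoly_1, Polynomial.coeff_X, Polynomial.coeff_one]
    obtain ⟨h0, h1⟩ := hc
    simp only [Finset.sum_range_succ, Finset.sum_range_zero, h0, h1, map_add,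
      map_sub, map_smul, add_apply, smul_apply,
      smul_eq_mul, Nat.reduceAdd, zero_add, hM (x 1) (x 0)]
    linarith [mul_nonneg (by norm_num : (0 : ℝ) ≤ (19/20)) (h 1 (-1) 0 0 0 0)]

theorem bdfPoly_2 : bdfPoly 2 =
    Polynomial.C (3/2) * Polynomial.X ^ 0 + Polynomial.C (-2) * Polynomial.X ^ 1 + Polynomial.C (1/2) * Polynomial.X ^ 2 := by
  refine Polynomial.funext fun r => ?_
  simp [bdfPoly, Finset.sum_Icc_succ_top]
  ring

theorem exists_bdf_energy_2 {H : Type*} [NormedAddCommGroup H] [InnerProductSpace ℝ H]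
    (M : H →L[ℝ] H →L[ℝ] ℝ) (hM : ∀ x y, M x y = M y x) (hM0 : ∀ x, 0 ≤ M x x) :
    ∃ (E : (ℕ → H) → ℝ) (γ Γ : ℝ), 0 < γ ∧ 0 < Γ ∧
      (∀ x, γ * M (x 0) (x 0) ≤ E x) ∧
      (∀ x, E x ≤ Γ * ∑ i ∈ Finset.range 2, M (x i) (x i)) ∧
      ∀ x, E x - E (fun i => x (i + 1)) ≤
        M (∑ ℓ ∈ Finset.range (2 + 1), bdfCoeff 2 ℓ • x ℓ) (x 0 - (9 / 10 : ℝ) • x 1) := by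
  refine ⟨fun x => (29/24) * M (x 0) (x 0) +
        (-34/15) * M (x 0) (x 1) +
        (133/120) * M (x 1) (x 1), (1/25), 3, by norm_num, by norm_num,
    fun x => ?_, fun x => ?_, fun x => ?_⟩
  · have h := quadratic_form_nonneg M hM hM0 x
    -- Squares are completed starting from the oldest value. The last pivot is the coefficient left
    -- on `M (x 0) (x 0)` after subtracting `γ`, so its sign is what limits `γ`.
    linarith [mul_nonneg (by norm_num : (0 : ℝ) ≤ (133/120)) (h (-136/133) 1 0 0 0 0),
      mul_nonneg (by norm_num : (0 : ℝ) ≤ (251/26600)) (h 1 0 0 0 0 0)]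
  · have h := quadratic_form_nonneg M hM hM0 x
    simp only [Finset.sum_range_succ, Finset.sum_range_zero]
    -- Diagonal dominance: each mixed term is absorbed by a square with entries `±1`, and `Γ` is
    -- large enough for the diagonal to pay.
    linarith [mul_nonneg (by norm_num : (0 : ℝ) ≤ (79/120)) (h 1 0 0 0 0 0),
      mul_nonneg (by norm_num : (0 : ℝ) ≤ (17/15)) (h 1 1 0 0 0 0),
      mul_nonneg (by norm_num : (0 : ℝ) ≤ (91/120)) (h 0 1 0 0 0 0)]
  · have h := quadratic_form_nonneg M hM hM0 x
    have hc : bdfCoeff 2 0 = (3/2) ∧ bdfCoeff 2 1 = (-2) ∧ bdfCoeff 2 2 = (1/2) := by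
      refine ⟨?_, ?_, ?_⟩ <;>
        simp [bdfCoeff, bdfPoly_2, Polynomial.coeff_X, Polynomial.coeff_C, Polynomial.coeff_X_pow]
    obtain ⟨h0, h1, h2⟩ := hc
    simp only [Finset.sum_range_succ, Finset.sum_range_zero, h0, h1, h2, map_add,
      map_sub, map_smul, add_apply, smul_apply,
      smul_eq_mul, Nat.reduceAdd, zero_add, hM (x 1) (x 0), hM (x 2) (x 0), hM (x 2) (x 1)]
    -- Here squares are completed from the newest value. The form vanishes on constant sequences,
    -- since the BDF coefficients sum to zero, so `k` squares suffice for `k + 1` values and the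
    -- last one is a difference of the two oldest.
    linarith [mul_nonneg (by norm_num : (0 : ℝ) ≤ (7/24)) (h 1 (-13/7) (6/7) 0 0 0),
      mul_nonneg (by norm_num : (0 : ℝ) ≤ (751/840)) (h 0 1 (-1) 0 0 0)]

theorem bdfPoly_3 : bdfPoly 3 =
    Polynomial.C (11/6) * Polynomial.X ^ 0 + Polynomial.C (-3) * Polynomial.X ^ 1 + Polynomial.C (3/2) * Polynomial.X ^ 2 + Polynomial.C (-1/3) * Polynomial.X ^ 3 := by
  refine Polynomial.funext fun r => ?_
  simp [bdfPoly, Finset.sum_Icc_succ_top]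
  ring

theorem exists_bdf_energy_3 {H : Type*} [NormedAddCommGroup H] [InnerProductSpace ℝ H]
    (M : H →L[ℝ] H →L[ℝ] ℝ) (hM : ∀ x y, M x y = M y x) (hM0 : ∀ x, 0 ≤ M x x) :
    ∃ (E : (ℕ → H) → ℝ) (γ Γ : ℝ), 0 < γ ∧ 0 < Γ ∧
      (∀ x, γ * M (x 0) (x 0) ≤ E x) ∧
      (∀ x, E x ≤ Γ * ∑ i ∈ Finset.range 3, M (x i) (x i)) ∧
      ∀ x, E x - E (fun i => x (i + 1)) ≤
        M (∑ ℓ ∈ Finset.range (3 + 1), bdfCoeff 3 ℓ • x ℓ) (x 0 - (9 / 10 : ℝ) • x 1) := by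
  refine ⟨fun x => (4957/3000) * M (x 0) (x 0) +
        (-3091/750) * M (x 0) (x 1) +
        1 * M (x 0) (x 2) +
        (217/60) * M (x 1) (x 1) +
        (-4843/1500) * M (x 1) (x 2) +
        (1131/1000) * M (x 2) (x 2), (1/25), 8, by norm_num, by norm_num,
    fun x => ?_, fun x => ?_, fun x => ?_⟩
  · have h := quadratic_form_nonneg M hM hM0 x
    linarith [mul_nonneg (by norm_num : (0 : ℝ) ≤ (1131/1000)) (h (500/1131) (-167/117) 1 0 0 0),
      mul_nonneg (by norm_num : (0 : ℝ) ≤ (460669/351000)) (h (-472794/460669) 1 0 0 0 0),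
      mul_nonneg (by norm_num : (0 : ℝ) ≤ (70899781/8015640600)) (h 1 0 0 0 0 0)]
  · have h := quadratic_form_nonneg M hM hM0 x
    simp only [Finset.sum_range_succ, Finset.sum_range_zero]
    linarith [mul_nonneg (by norm_num : (0 : ℝ) ≤ (3787/1000)) (h 1 0 0 0 0 0),
      mul_nonneg (by norm_num : (0 : ℝ) ≤ (3091/1500)) (h 1 1 0 0 0 0),
      mul_nonneg (by norm_num : (0 : ℝ) ≤ (1/2)) (h 1 0 (-1) 0 0 0),
      mul_nonneg (by norm_num : (0 : ℝ) ≤ (17/24)) (h 0 1 0 0 0 0),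
      mul_nonneg (by norm_num : (0 : ℝ) ≤ (4843/3000)) (h 0 1 1 0 0 0),
      mul_nonneg (by norm_num : (0 : ℝ) ≤ (1783/375)) (h 0 0 1 0 0 0)]
  · have h := quadratic_form_nonneg M hM hM0 x
    have hc : bdfCoeff 3 0 = (11/6) ∧ bdfCoeff 3 1 = (-3) ∧ bdfCoeff 3 2 = (3/2) ∧ bdfCoeff 3 3 = (-1/3) := by
      refine ⟨?_, ?_, ?_, ?_⟩ <;>
        simp [bdfCoeff, bdfPoly_3, Polynomial.coeff_X, Polynomial.coeff_C, Polynomial.coeff_X_pow]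
    obtain ⟨h0, h1, h2, h3⟩ := hc
    simp only [Finset.sum_range_succ, Finset.sum_range_zero, h0, h1, h2, h3, map_add,
      map_sub, map_smul, add_apply, smul_apply,
      smul_eq_mul, Nat.reduceAdd, zero_add, hM (x 1) (x 0), hM (x 2) (x 0), hM (x 3) (x 0), hM (x 2) (x 1), hM (x 3) (x 1)]
    linarith [mul_nonneg (by norm_num : (0 : ℝ) ≤ (181/1000)) (h 1 (-793/543) (250/181) (-500/543) 0 0),
      mul_nonneg (by norm_num : (0 : ℝ) ≤ (71194/203625)) (h 0 1 (-615951/284776) (331175/284776) 0 0),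
      mul_nonneg (by norm_num : (0 : ℝ) ≤ (215583109/427164000)) (h 0 0 1 (-1) 0 0)]

theorem bdfPoly_4 : bdfPoly 4 =
    Polynomial.C (25/12) * Polynomial.X ^ 0 + Polynomial.C (-4) * Polynomial.X ^ 1 + Polynomial.C 3 * Polynomial.X ^ 2 + Polynomial.C (-4/3) * Polynomial.X ^ 3 + Polynomial.C (1/4) * Polynomial.X ^ 4 := by
  refine Polynomial.funext fun r => ?_
  simp [bdfPoly, Finset.sum_Icc_succ_top]
  ring

theorem exists_bdf_energy_4 {H : Type*} [NormedAddCommGroup H] [InnerProductSpace ℝ H]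
    (M : H →L[ℝ] H →L[ℝ] ℝ) (hM : ∀ x y, M x y = M y x) (hM0 : ∀ x, 0 ≤ M x x) :
    ∃ (E : (ℕ → H) → ℝ) (γ Γ : ℝ), 0 < γ ∧ 0 < Γ ∧
      (∀ x, γ * M (x 0) (x 0) ≤ E x) ∧
      (∀ x, E x ≤ Γ * ∑ i ∈ Finset.range 4, M (x i) (x i)) ∧
      ∀ x, E x - E (fun i => x (i + 1)) ≤
        M (∑ ℓ ∈ Finset.range (4 + 1), bdfCoeff 4 ℓ • x ℓ) (x 0 - (9 / 10 : ℝ) • x 1) := by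
  refine ⟨fun x => (742/375) * M (x 0) (x 0) +
        (-16697/3000) * M (x 0) (x 1) +
        (83/30) * M (x 0) (x 2) +
        (-19/20) * M (x 0) (x 3) +
        (2543/500) * M (x 1) (x 1) +
        (-20669/3000) * M (x 1) (x 2) +
        (251/120) * M (x 1) (x 3) +
        (3787/1000) * M (x 2) (x 2) +
        (-2507/750) * M (x 2) (x 3) +
        (136/125) * M (x 3) (x 3), (1/25), 13, by norm_num, by norm_num,
    fun x => ?_, fun x => ?_, fun x => ?_⟩
  · have h := quadratic_form_nonneg M hM hM0 x
    linarith [mul_nonneg (by norm_num : (0 : ℝ) ≤ (136/125)) (h (-475/1088) (6275/6528) (-2507/1632) 1 0 0),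
      mul_nonneg (by norm_num : (0 : ℝ) ≤ (2985527/2448000)) (h (3200325/5971054) (-18000383/11942108) 1 0 0 0),
      mul_nonneg (by norm_num : (0 : ℝ) ≤ (187710074027/143305296000)) (h (-192169056102/187710074027) 1 0 0 0 0),
      mul_nonneg (by norm_num : (0 : ℝ) ≤ (913941424787/112626044416200)) (h 1 0 0 0 0 0)]
  · have h := quadratic_form_nonneg M hM hM0 x
    simp only [Finset.sum_range_succ, Finset.sum_range_zero]
    linarith [mul_nonneg (by norm_num : (0 : ℝ) ≤ (38281/6000)) (h 1 0 0 0 0 0),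
      mul_nonneg (by norm_num : (0 : ℝ) ≤ (16697/6000)) (h 1 1 0 0 0 0),
      mul_nonneg (by norm_num : (0 : ℝ) ≤ (83/60)) (h 1 0 (-1) 0 0 0),
      mul_nonneg (by norm_num : (0 : ℝ) ≤ (19/40)) (h 1 0 0 1 0 0),
      mul_nonneg (by norm_num : (0 : ℝ) ≤ (1281/2000)) (h 0 1 0 0 0 0),
      mul_nonneg (by norm_num : (0 : ℝ) ≤ (20669/6000)) (h 0 1 1 0 0 0),
      mul_nonneg (by norm_num : (0 : ℝ) ≤ (251/240)) (h 0 1 0 (-1) 0 0),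
      mul_nonneg (by norm_num : (0 : ℝ) ≤ (5427/2000)) (h 0 0 1 0 0 0),
      mul_nonneg (by norm_num : (0 : ℝ) ≤ (2507/1500)) (h 0 0 1 1 0 0),
      mul_nonneg (by norm_num : (0 : ℝ) ≤ (52319/6000)) (h 0 0 0 1 0 0)]
  · have h := quadratic_form_nonneg M hM hM0 x
    have hc : bdfCoeff 4 0 = (25/12) ∧ bdfCoeff 4 1 = (-4) ∧ bdfCoeff 4 2 = 3 ∧ bdfCoeff 4 3 = (-4/3) ∧ bdfCoeff 4 4 = (1/4) := by
      refine ⟨?_, ?_, ?_, ?_, ?_⟩ <;>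
        simp [bdfCoeff, bdfPoly_4, Polynomial.coeff_X, Polynomial.coeff_C, Polynomial.coeff_X_pow]
    obtain ⟨h0, h1, h2, h3, h4⟩ := hc
    simp only [Finset.sum_range_succ, Finset.sum_range_zero, h0, h1, h2, h3, h4, map_add,
      map_sub, map_smul, add_apply, smul_apply,
      smul_eq_mul, Nat.reduceAdd, zero_add, hM (x 1) (x 0), hM (x 2) (x 0), hM (x 3) (x 0), hM (x 4) (x 0), hM (x 2) (x 1), hM (x 3) (x 1), hM (x 4) (x 1)]
    linarith [mul_nonneg (by norm_num : (0 : ℝ) ≤ (157/1500)) (h 1 (-232/157) (175/157) (-575/314) (375/314) 0),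
      mul_nonneg (by norm_num : (0 : ℝ) ≤ (20733/78500)) (h 0 1 (-121424/62199) (616325/248796) (-126475/82932) 0),
      mul_nonneg (by norm_num : (0 : ℝ) ≤ (30305017/186597000)) (h 0 0 1 (-105463409/60610034) (44853375/60610034) 0),
      mul_nonneg (by norm_num : (0 : ℝ) ≤ (57096138593/242440136000)) (h 0 0 0 1 (-1) 0)]

theorem bdfPoly_5 : bdfPoly 5 =
    Polynomial.C (137/60) * Polynomial.X ^ 0 + Polynomial.C (-5) * Polynomial.X ^ 1 + Polynomial.C 5 * Polynomial.X ^ 2 + Polynomial.C (-10/3) * Polynomial.X ^ 3 + Polynomial.C (5/4) * Polynomial.X ^ 4 + Polynomial.C (-1/5) * Polynomial.X ^ 5 := by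
  refine Polynomial.funext fun r => ?_
  simp [bdfPoly, Finset.sum_Icc_succ_top]
  ring

theorem exists_bdf_energy_5 {H : Type*} [NormedAddCommGroup H] [InnerProductSpace ℝ H]
    (M : H →L[ℝ] H →L[ℝ] ℝ) (hM : ∀ x y, M x y = M y x) (hM0 : ∀ x, 0 ≤ M x x) :
    ∃ (E : (ℕ → H) → ℝ) (γ Γ : ℝ), 0 < γ ∧ 0 < Γ ∧
      (∀ x, γ * M (x 0) (x 0) ≤ E x) ∧
      (∀ x, E x ≤ Γ * ∑ i ∈ Finset.range 5, M (x i) (x i)) ∧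
      ∀ x, E x - E (fun i => x (i + 1)) ≤
        M (∑ ℓ ∈ Finset.range (5 + 1), bdfCoeff 5 ℓ • x ℓ) (x 0 - (9 / 10 : ℝ) • x 1) := by
  refine ⟨fun x => (33871/15000) * M (x 0) (x 0) +
        (-103567/15000) * M (x 0) (x 1) +
        (71/15) * M (x 0) (x 2) +
        (-46/15) * M (x 0) (x 3) +
        (19/20) * M (x 0) (x 4) +
        (95863/15000) * M (x 1) (x 1) +
        (-147809/15000) * M (x 1) (x 2) +
        (3721/600) * M (x 1) (x 3) +
        (-749/300) * M (x 1) (x 4) +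
        (2807/600) * M (x 2) (x 2) +
        (-8093/1250) * M (x 2) (x 3) +
        (37/15) * M (x 2) (x 4) +
        (45137/15000) * M (x 3) (x 3) +
        (-20879/7500) * M (x 3) (x 4) +
        (14129/15000) * M (x 4) (x 4), (1/25), 20, by norm_num, by norm_num,
    fun x => ?_, fun x => ?_, fun x => ?_⟩
  · have h := quadratic_form_nonneg M hM hM0 x
    linarith [mul_nonneg (by norm_num : (0 : ℝ) ≤ (14129/15000)) (h (7125/14129) (-18725/14129) (18500/14129) (-20879/14129) 1 0),
      mul_nonneg (by norm_num : (0 : ℝ) ≤ (8408668/8830625)) (h (-176204125/201808032) (177477225/134538688) (-149907241/100904016) 1 0 0),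
      mul_nonneg (by norm_num : (0 : ℝ) ≤ (727858673911/756780120000)) (h (771229460875/1455717347822) (-4317580069869/2911434695644) 1 0 0 0),
      mul_nonneg (by norm_num : (0 : ℝ) ≤ (168447203628854021/174686081738640000)) (h (-9970714983317738/9908659036991413) 1 0 0 0 0),
      mul_nonneg (by norm_num : (0 : ℝ) ≤ (37176906248969353/5945195422194847800)) (h 1 0 0 0 0 0)]
  · have h := quadratic_form_nonneg M hM hM0 x
    simp only [Finset.sum_range_succ, Finset.sum_range_zero]
    linarith [mul_nonneg (by norm_num : (0 : ℝ) ≤ (99147/10000)) (h 1 0 0 0 0 0),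
      mul_nonneg (by norm_num : (0 : ℝ) ≤ (103567/30000)) (h 1 1 0 0 0 0),
      mul_nonneg (by norm_num : (0 : ℝ) ≤ (71/30)) (h 1 0 (-1) 0 0 0),
      mul_nonneg (by norm_num : (0 : ℝ) ≤ (23/15)) (h 1 0 0 1 0 0),
      mul_nonneg (by norm_num : (0 : ℝ) ≤ (19/40)) (h 1 0 0 0 (-1) 0),
      mul_nonneg (by norm_num : (0 : ℝ) ≤ (26423/30000)) (h 0 1 0 0 0 0),
      mul_nonneg (by norm_num : (0 : ℝ) ≤ (147809/30000)) (h 0 1 1 0 0 0),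
      mul_nonneg (by norm_num : (0 : ℝ) ≤ (3721/1200)) (h 0 1 0 (-1) 0 0),
      mul_nonneg (by norm_num : (0 : ℝ) ≤ (749/600)) (h 0 1 0 0 1 0),
      mul_nonneg (by norm_num : (0 : ℝ) ≤ (1423/400)) (h 0 0 1 0 0 0),
      mul_nonneg (by norm_num : (0 : ℝ) ≤ (8093/2500)) (h 0 0 1 1 0 0),
      mul_nonneg (by norm_num : (0 : ℝ) ≤ (37/30)) (h 0 0 1 0 (-1) 0),
      mul_nonneg (by norm_num : (0 : ℝ) ≤ (231827/30000)) (h 0 0 0 1 0 0),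
      mul_nonneg (by norm_num : (0 : ℝ) ≤ (20879/15000)) (h 0 0 0 1 1 0),
      mul_nonneg (by norm_num : (0 : ℝ) ≤ (110321/7500)) (h 0 0 0 0 1 0)]
  · have h := quadratic_form_nonneg M hM hM0 x
    have hc : bdfCoeff 5 0 = (137/60) ∧ bdfCoeff 5 1 = (-5) ∧ bdfCoeff 5 2 = 5 ∧ bdfCoeff 5 3 = (-10/3) ∧ bdfCoeff 5 4 = (5/4) ∧ bdfCoeff 5 5 = (-1/5) := by
      refine ⟨?_, ?_, ?_, ?_, ?_, ?_⟩ <;>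
        simp [bdfCoeff, bdfPoly_5, Polynomial.coeff_X, Polynomial.coeff_C, Polynomial.coeff_X_pow]
    obtain ⟨h0, h1, h2, h3, h4, h5⟩ := hc
    simp only [Finset.sum_range_succ, Finset.sum_range_zero, h0, h1, h2, h3, h4, h5, map_add,
      map_sub, map_smul, add_apply, smul_apply,
      smul_eq_mul, Nat.reduceAdd, zero_add, hM (x 1) (x 0), hM (x 2) (x 0), hM (x 3) (x 0), hM (x 4) (x 0), hM (x 5) (x 0), hM (x 2) (x 1), hM (x 3) (x 1), hM (x 4) (x 1), hM (x 5) (x 1)]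
    linarith [mul_nonneg (by norm_num : (0 : ℝ) ≤ (379/15000)) (h 1 (-1129/379) (2000/379) (-2000/379) (2250/379) (-1500/379)),
      mul_nonneg (by norm_num : (0 : ℝ) ≤ (812891/5685000)) (h 0 1 (-2149391/812891) (4191525/1625782) (-4555575/1625782) (1518525/812891)),
      mul_nonneg (by norm_num : (0 : ℝ) ≤ (112558069/12193365000)) (h 0 0 1 (-139094619/112558069) (201543300/112558069) (-175006750/112558069)),
      mul_nonneg (by norm_num : (0 : ℝ) ≤ (7189587479/6753484140000)) (h 0 0 0 1 (-2044974229/7189587479) (-5144613250/7189587479)),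
      mul_nonneg (by norm_num : (0 : ℝ) ≤ (2622390855791/107843812185000)) (h 0 0 0 0 1 (-1))]

/-- `G`-stability of BDF-`k`, `k ≤ 5`, with the multiplier `x⁰ - (9/10) x¹`. The energy `E` is a
quadratic form in the last `k` values, listed from the newest to the oldest. -/
theorem exists_bdf_energy {H : Type*} [NormedAddCommGroup H] [InnerProductSpace ℝ H]
    (M : H →L[ℝ] H →L[ℝ] ℝ) (hM : ∀ x y, M x y = M y x) (hM0 : ∀ x, 0 ≤ M x x)
    {k : ℕ} (hk1 : 1 ≤ k) (hk5 : k ≤ 5) :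
    ∃ (E : (ℕ → H) → ℝ) (γ Γ : ℝ), 0 < γ ∧ 0 < Γ ∧
      (∀ x, γ * M (x 0) (x 0) ≤ E x) ∧
      (∀ x, E x ≤ Γ * ∑ i ∈ Finset.range k, M (x i) (x i)) ∧
      ∀ x, E x - E (fun i => x (i + 1)) ≤
        M (∑ ℓ ∈ Finset.range (k + 1), bdfCoeff k ℓ • x ℓ) (x 0 - (9 / 10 : ℝ) • x 1) := by
  interval_cases k
  exacts [exists_bdf_energy_1 M hM hM0, exists_bdf_energy_2 M hM hM0, exists_bdf_energy_3 M hM hM0,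
    exists_bdf_energy_4 M hM hM0, exists_bdf_energy_5 M hM hM0]

/-! ### Order conditions and elementary inequalities. -/

/-- The order conditions: the BDF-`k` operator is exact on polynomials of degree at most `k`. -/
theorem bdfCoeff_order {k : ℕ} (hk1 : 1 ≤ k) (hk5 : k ≤ 5) {j : ℕ} (hj : j ≤ k) :
    ∑ ℓ ∈ Finset.range (k + 1), bdfCoeff k ℓ * ((k : ℝ) - ℓ) ^ j = j * (k : ℝ) ^ (j - 1) := by
  have h : ∀ ℓ, bdfCoeff k ℓ = (bdfPoly k).coeff ℓ := fun _ => rfl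
  simp only [h]
  interval_cases k <;> interval_cases j <;>
    norm_num [bdfPoly_1, bdfPoly_2, bdfPoly_3, bdfPoly_4, bdfPoly_5, Finset.sum_range_succ,
      Polynomial.coeff_X, Polynomial.coeff_C, Polynomial.coeff_X_pow,
          Polynomial.coeff_one]

theorem bdfCoeff_zero_pos {k : ℕ} (hk1 : 1 ≤ k) (hk5 : k ≤ 5) : 0 < bdfCoeff k 0 := by
  unfold bdfCoeff
  interval_cases k <;>
    simp [bdfPoly_1, bdfPoly_2, bdfPoly_3, bdfPoly_4, bdfPoly_5, Polynomial.coeff_X]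

theorem norm_sum_smul_sq_le {H : Type*} [NormedAddCommGroup H] [InnerProductSpace ℝ H]
    (k : ℕ) (ξ : ℕ → ℝ) (x : ℕ → H) :
    ‖∑ i ∈ Finset.range k, ξ i • x i‖ ^ 2 ≤
      (∑ i ∈ Finset.range k, ξ i ^ 2) * ∑ i ∈ Finset.range k, ‖x i‖ ^ 2 := by
  have h : ‖∑ i ∈ Finset.range k, ξ i • x i‖ ≤ ∑ i ∈ Finset.range k, |ξ i| * ‖x i‖ :=
    (norm_sum_le _ _).trans (le_of_eq (Finset.sum_congr rfl fun i _ => norm_smul _ _))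
  calc ‖∑ i ∈ Finset.range k, ξ i • x i‖ ^ 2
      ≤ (∑ i ∈ Finset.range k, |ξ i| * ‖x i‖) ^ 2 := by gcongr
    _ ≤ (∑ i ∈ Finset.range k, |ξ i| ^ 2) * ∑ i ∈ Finset.range k, ‖x i‖ ^ 2 :=
        Finset.sum_mul_sq_le_sq_mul_sq _ _ _
    _ = _ := by simp

theorem sum_range_reflect_le {k : ℕ} (f : ℕ → ℝ) (hf : ∀ i, 0 ≤ f i) :
    ∑ i ∈ Finset.range k, f (k - i) ≤ f k + ∑ i ∈ Finset.range k, f i := by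
  have h := Finset.sum_range_succ (fun i => f (k - i)) k
  have h' := Finset.sum_range_reflect f (k + 1)
  simp only [Nat.add_sub_cancel] at h'
  rw [Finset.sum_range_succ f k] at h'
  have := hf (k - k)
  linarith

theorem bilin_self_le {H : Type*} [NormedAddCommGroup H] [InnerProductSpace ℝ H]
    (M : H →L[ℝ] H →L[ℝ] ℝ) (x : H) : M x x ≤ ‖M‖ * ‖x‖ ^ 2 := by
  have := (le_abs_self _).trans (M.le_opNorm₂ x x)
  linarith [sq ‖x‖, mul_assoc ‖M‖ ‖x‖ ‖x‖]

/-- The dual pairing absorbed into an elliptic form. -/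
theorem dual_apply_le {Q : Type*} [NormedAddCommGroup Q] [InnerProductSpace ℝ Q]
    (ρ : Q →L[ℝ] ℝ) (q : Q) {ε : ℝ} (hε : 0 < ε) :
    ρ q ≤ ε * ‖q‖ ^ 2 + ‖ρ‖ ^ 2 / (4 * ε) := by
  have h1 : ρ q ≤ ‖ρ‖ * ‖q‖ := (le_abs_self _).trans (ρ.le_opNorm q)
  have h2 : ε * ‖q‖ ^ 2 + ‖ρ‖ ^ 2 / (4 * ε) - ‖ρ‖ * ‖q‖
      = (2 * ε * ‖q‖ - ‖ρ‖) ^ 2 / (4 * ε) := by field_simp; ring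
  have h3 : 0 ≤ (2 * ε * ‖q‖ - ‖ρ‖) ^ 2 / (4 * ε) := by positivity
  linarith

/-! ### Energy stability of BDF-`k` with residuals in the dual of `Q`. -/

section Stability

variable {Q H : Type*} [NormedAddCommGroup Q] [InnerProductSpace ℝ Q]
  [NormedAddCommGroup H] [InnerProductSpace ℝ H]

/-- The first step, where only the newest value is known to lie in `Q`. -/
theorem bdf_first_step (ι : Q →L[ℝ] H) (M : H →L[ℝ] H →L[ℝ] ℝ) (b : Q →L[ℝ] Q →L[ℝ] ℝ)
    (hM : ∀ x y, M x y = M y x) (hM0 : ∀ x, 0 ≤ M x x)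
    {cb : ℝ} (hcb : 0 < cb) (hbe : ∀ q, cb * ‖q‖ ^ 2 ≤ b q q)
    {ξ τ : ℝ} (hξ : 0 < ξ) (hτ : 0 < τ) (s : H) (q : Q) (ρ : Q →L[ℝ] ℝ)
    (heq : 1 / τ * M (ξ • ι q + s) (ι q) + b q q = ρ q) :
    ξ * M (ι q) (ι q) + τ * b q q ≤ ‖M‖ / ξ * ‖s‖ ^ 2 + τ * (‖ρ‖ ^ 2 / cb) := by
  have h1 := dual_apply_le ρ q (half_pos hcb)
  have h2 := hbe q
  -- Young's inequality for `M s (ι q)` in the `M`-seminorm; dividing this square by `ξ` leaves half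
  -- of `ξ M (ι q) (ι q)` on the left.
  have h3 := hM0 (s + ξ • ι q)
  simp only [map_add, map_smul, add_apply, smul_apply, smul_eq_mul, hM (ι q) s] at h3 heq
  have h4 := bilin_self_le M s
  have h5 : ξ * M (ι q) (ι q) + M s (ι q) + τ * b q q = τ * ρ q := by
    rw [← heq]; field_simp
  have h6 : τ * ρ q ≤ τ * (b q q / 2 + ‖ρ‖ ^ 2 / cb / 2) := by
    gcongr
    have : ‖ρ‖ ^ 2 / (4 * (cb / 2)) = ‖ρ‖ ^ 2 / cb / 2 := by field_simp; ring
    linarith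
  have h7 : -(M s (ι q)) ≤ (‖M‖ * ‖s‖ ^ 2) / ξ / 2 + ξ * M (ι q) (ι q) / 2 := by
    have : 0 ≤ (‖M‖ * ‖s‖ ^ 2 + ξ * M s (ι q) + (ξ * M s (ι q) + ξ * (ξ * M (ι q) (ι q)))) / ξ :=
      div_nonneg (by linarith) hξ.le
    have e : (‖M‖ * ‖s‖ ^ 2 + ξ * M s (ι q) + (ξ * M s (ι q) + ξ * (ξ * M (ι q) (ι q)))) / ξ
        = ‖M‖ * ‖s‖ ^ 2 / ξ + 2 * M s (ι q) + ξ * M (ι q) (ι q) := by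
      field_simp; ring
    linarith
  have h8 : ‖M‖ / ξ * ‖s‖ ^ 2 = ‖M‖ * ‖s‖ ^ 2 / ξ := by ring
  rw [h8]
  linarith

/-- One step of the energy estimate with the multiplier `e^n - η e^{n-1}`, `η = 9/10`. -/
theorem bdf_energy_step (ι : Q →L[ℝ] H) (M : H →L[ℝ] H →L[ℝ] ℝ) (b : Q →L[ℝ] Q →L[ℝ] ℝ)
    (hb : ∀ q r, b q r = b r q)
    {cb : ℝ} (hcb : 0 < cb) (hbe : ∀ q, cb * ‖q‖ ^ 2 ≤ b q q)
    {τ E E' : ℝ} (hτ : 0 < τ) (s : H) (q r : Q) (ρ : Q →L[ℝ] ℝ)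
    (heq : ∀ z, 1 / τ * M s (ι z) + b q z = ρ z)
    (hE : E - E' ≤ M s (ι q - (9 / 10 : ℝ) • ι r)) :
    E + τ / 2 * b q q ≤ E' + τ / 2 * b r r + τ * (10 / cb * ‖ρ‖ ^ 2) := by
  have h1 := heq (q - (9 / 10 : ℝ) • r)
  simp only [map_sub, map_smul, smul_eq_mul] at h1 hE
  -- With `b q r ≤ (b q q + b r r) / 2` the coefficients of `b q q` and `b r r` are `-0.55` and
  -- `0.45`. The weights `cb/20` and `cb/18` spend exactly `0.05` on each, giving `∓1/2`, so these
  -- terms telescope.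
  have h2 := dual_apply_le ρ q (ε := cb / 20) (by positivity)
  have h3 := dual_apply_le (-ρ) r (ε := cb / 18) (by positivity)
  simp only [neg_apply, norm_neg] at h3
  have h4 : 0 ≤ b (q - r) (q - r) := le_trans (by positivity) (hbe _)
  simp only [map_sub, sub_apply, hb r q] at h4
  have h5 := hbe q
  have h6 := hbe r
  have e1 : ‖ρ‖ ^ 2 / (4 * (cb / 20)) = 5 * (‖ρ‖ ^ 2 / cb) := by field_simp; ring
  have e2 : ‖ρ‖ ^ 2 / (4 * (cb / 18)) = (9 / 2) * (‖ρ‖ ^ 2 / cb) := by field_simp; ring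
  have e3 : 10 / cb * ‖ρ‖ ^ 2 = 10 * (‖ρ‖ ^ 2 / cb) := by ring
  have h0 : 0 ≤ ‖ρ‖ ^ 2 / cb := by positivity
  rw [e1] at h2
  rw [e2] at h3
  rw [e3]
  have h7 : M s (ι q) - 9 / 10 * M s (ι r)
      = τ * (ρ q - 9 / 10 * ρ r - b q q + 9 / 10 * b q r) := by
    have : ρ q - 9 / 10 * ρ r - b q q + 9 / 10 * b q r
      = 1 / τ * (M s (ι q) - 9 / 10 * M s (ι r)) := by linarith
    rw [this]; field_simp
  have h8 : τ * (ρ q - 9 / 10 * ρ r - b q q + 9 / 10 * b q r) ≤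
      τ * (b r r / 2 - b q q / 2 + 10 * (‖ρ‖ ^ 2 / cb)) :=
    mul_le_mul_of_nonneg_left (by linarith) hτ.le
  linarith

/-- Stability of the BDF-`k` method, `k ≤ 5`, with right-hand side measured in the dual of `Q` and
starting values measured in `H`. -/
theorem bdf_stability (ι : Q →L[ℝ] H) (M : H →L[ℝ] H →L[ℝ] ℝ) (b : Q →L[ℝ] Q →L[ℝ] ℝ)
    (hM : ∀ x y, M x y = M y x) (hb : ∀ q r, b q r = b r q)
    {cb cc : ℝ} (hcb : 0 < cb) (hcc : 0 < cc)
    (hMe : ∀ x, cc * ‖x‖ ^ 2 ≤ M x x) (hbe : ∀ q, cb * ‖q‖ ^ 2 ≤ b q q)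
    {k : ℕ} (hk1 : 1 ≤ k) (hk5 : k ≤ 5) :
    ∃ K > (0 : ℝ), ∀ (τ : ℝ) (N : ℕ) (e : ℕ → H) (eQ : ℕ → Q) (ρ : ℕ → Q →L[ℝ] ℝ), 0 < τ →
      (∀ n, k ≤ n → n ≤ N → ι (eQ n) = e n) →
      (∀ n, k ≤ n → n ≤ N → ∀ z, 1 / τ * M (∑ ℓ ∈ Finset.range (k + 1), bdfCoeff k ℓ • e (n - ℓ))
        (ι z) + b (eQ n) z = ρ n z) →
      ∀ n, k ≤ n → n ≤ N → ‖e n‖ ^ 2 ≤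
        K * (∑ ℓ ∈ Finset.range k, ‖e ℓ‖ ^ 2 + τ * ∑ m ∈ Finset.Icc k n, ‖ρ m‖ ^ 2) := by
  have hM0 : ∀ x, 0 ≤ M x x := fun x => le_trans (by positivity) (hMe x)
  obtain ⟨E, γ, Γ, hγ, hΓ, hlow, hup, hstep⟩ := exists_bdf_energy M hM hM0 hk1 hk5
  have hξ := bdfCoeff_zero_pos hk1 hk5
  set ξ := bdfCoeff k 0 with hξdef
  set Ξ := ∑ i ∈ Finset.range k, bdfCoeff k (i + 1) ^ 2 with hΞ
  have hΞ0 : 0 ≤ Ξ := Finset.sum_nonneg fun _ _ => sq_nonneg _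
  -- All of `A` except `10 / cb` pays for the energy after the first step; `10 / cb` is the price of
  -- the residual in each step.
  set A := (Γ / ξ + 1) * (‖M‖ / ξ * (Ξ * 2) + 1 / cb) + Γ * ‖M‖ + 10 / cb with hA
  have hApos : 0 < A := by positivity
  refine ⟨A / (γ * cc), by positivity, fun τ N e eQ ρ hτ hι heq n hkn hnN => ?_⟩
  set Z := ∑ ℓ ∈ Finset.range k, ‖e ℓ‖ ^ 2 with hZ
  have hZ0 : 0 ≤ Z := Finset.sum_nonneg fun _ _ => sq_nonneg _
  -- the first step
  have hkN := hkn.trans hnN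
  set s := ∑ ℓ ∈ Finset.range k, bdfCoeff k (ℓ + 1) • e (k - (ℓ + 1)) with hs
  have hs2 : ‖s‖ ^ 2 ≤ Ξ * Z := by
    refine (norm_sum_smul_sq_le _ _ _).trans (le_of_eq ?_)
    congr 1
    rw [hZ, ← Finset.sum_range_reflect (fun i => ‖e i‖ ^ 2) k]
    refine Finset.sum_congr rfl fun i _ => ?_
    rw [show k - (i + 1) = k - 1 - i by omega]
  -- At `n = k` the usual multiplier would contain `e (k - 1)`, a starting error that need not lie
  -- in `Q`; the test function is therefore the newest error alone.
  have h1 := bdf_first_step ι M b hM hM0 hcb hbe hξ hτ s (eQ k) (ρ k) (by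
    rw [← heq k le_rfl hkN (eQ k), Finset.sum_range_succ', hι k le_rfl hkN, add_comm s]; rfl)
  rw [hι k le_rfl hkN] at h1
  have hbk : 0 ≤ b (eQ k) (eQ k) := le_trans (by positivity) (hbe _)
  set W := Z + τ * ‖ρ k‖ ^ 2 with hW
  have hW0 : 0 ≤ W := by positivity
  have h2 : ξ * M (e k) (e k) + τ * b (eQ k) (eQ k) ≤ (‖M‖ / ξ * (Ξ * 2) + 1 / cb) * W := by
    have a1 : ‖M‖ / ξ * ‖s‖ ^ 2 ≤ ‖M‖ / ξ * (Ξ * Z) := by gcongr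
    have a2 : 0 ≤ ‖M‖ / ξ * (Ξ * Z) := by positivity
    have a3 : 0 ≤ ‖M‖ / ξ * (Ξ * 2) * (τ * ‖ρ k‖ ^ 2) := by positivity
    have a4 : 0 ≤ 1 / cb * Z := by positivity
    have a5 : τ * (‖ρ k‖ ^ 2 / cb) = 1 / cb * (τ * ‖ρ k‖ ^ 2) := by ring
    rw [hW]
    linarith
  have hEk : E (fun i => e (k - i)) + τ / 2 * b (eQ k) (eQ k) ≤ (A - 10 / cb) * W := by
    have a1 := hup (fun i => e (k - i))
    have a2 := sum_range_reflect_le (k := k) (fun i => M (e i) (e i)) (fun i => hM0 _)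
    have a3 : ∑ i ∈ Finset.range k, M (e i) (e i) ≤ ‖M‖ * Z := by
      rw [hZ, Finset.mul_sum]
      exact Finset.sum_le_sum fun i _ => bilin_self_le M _
    have a4 : Γ * ∑ i ∈ Finset.range k, M (e (k - i)) (e (k - i)) ≤ Γ * (M (e k) (e k) + ‖M‖ * Z) := by
      gcongr; linarith
    have a5 : M (e k) (e k) ≤ (‖M‖ / ξ * (Ξ * 2) + 1 / cb) * W / ξ := by
      rw [le_div_iff₀ hξ]
      nlinarith [mul_nonneg hτ.le hbk]
    have a6 : Γ * M (e k) (e k) ≤ Γ * ((‖M‖ / ξ * (Ξ * 2) + 1 / cb) * W / ξ) := by gcongr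
    have a7 : τ * b (eQ k) (eQ k) ≤ (‖M‖ / ξ * (Ξ * 2) + 1 / cb) * W := by
      have := mul_nonneg hξ.le (hM0 (e k))
      linarith
    have a8 : (A - 10 / cb) * W = Γ * ((‖M‖ / ξ * (Ξ * 2) + 1 / cb) * W / ξ) +
        (‖M‖ / ξ * (Ξ * 2) + 1 / cb) * W + Γ * ‖M‖ * Z + Γ * ‖M‖ * (τ * ‖ρ k‖ ^ 2) := by
      rw [hA, hW]; ring
    have a9 : 0 ≤ Γ * ‖M‖ * (τ * ‖ρ k‖ ^ 2) := by positivity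
    have a10 := mul_nonneg hτ.le hbk
    rw [a8]
    linarith
  -- the remaining steps
  have key : ∀ n, k ≤ n → n ≤ N → E (fun i => e (n - i)) + τ / 2 * b (eQ n) (eQ n) ≤
      A * (Z + τ * ∑ m ∈ Finset.Icc k n, ‖ρ m‖ ^ 2) := by
    intro n hkn
    induction n, hkn using Nat.le_induction with
    | base =>
      intro _
      have : 0 ≤ 10 / cb * W := by positivity
      simp only [Finset.Icc_self, Finset.sum_singleton]
      linarith
    | succ n hkn ih =>
      intro hnN
      have ih := ih (by omega)
      have h3 := bdf_energy_step (E := E (fun i => e (n + 1 - i))) (E' := E (fun i => e (n - i)))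
        ι M b hb hcb hbe hτ _ (eQ (n + 1)) (eQ n) (ρ (n + 1)) (heq (n + 1) (by omega) hnN) (by
          have := hstep (fun i => e (n + 1 - i))
          -- Because `n + 1 - (i + 1) = n - i` also for truncated subtraction, the shifted history
          -- is exactly the history at step `n`.
          simp only [Nat.add_sub_add_right] at this
          rw [hι (n + 1) (by omega) hnN, hι n hkn (by omega)]
          simpa using this)
      rw [Finset.sum_Icc_succ_top (by omega)]
      have : τ * (10 / cb * ‖ρ (n + 1)‖ ^ 2) ≤ τ * (A * ‖ρ (n + 1)‖ ^ 2) := by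
        gcongr
        rw [hA]
        have : 0 ≤ (Γ / ξ + 1) * (‖M‖ / ξ * (Ξ * 2) + 1 / cb) + Γ * ‖M‖ := by positivity
        linarith
      linarith
  have h4 := key n hkn hnN
  have h5 := hlow (fun i => e (n - i))
  simp only [Nat.sub_zero] at h5
  have h6 : 0 ≤ τ / 2 * b (eQ n) (eQ n) :=
    mul_nonneg (by positivity) (le_trans (by positivity) (hbe _))
  have h7 : γ * (cc * ‖e n‖ ^ 2) ≤ γ * M (e n) (e n) := by gcongr; exact hMe _
  rw [div_mul_eq_mul_div, le_div_iff₀ (by positivity)]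
  linarith

end Stability

/-! ### Taylor expansion and truncation error. -/

section Truncation

variable {E : Type*} [NormedAddCommGroup E] [NormedSpace ℝ E]

/-- The polynomial `∑_{i ≤ m} (s - a)^i / i! • c i`. -/
noncomputable def taylorSum (a : ℝ) (m : ℕ) (c : ℕ → E) (s : ℝ) : E :=
  ∑ i ∈ Finset.range (m + 1), ((s - a) ^ i / (i.factorial : ℝ)) • c i

theorem taylorSum_self (a : ℝ) (m : ℕ) (c : ℕ → E) : taylorSum a m c a = c 0 := by
  simp [taylorSum, Finset.sum_range_succ']

theorem hasDerivAt_taylorSum (a : ℝ) (m : ℕ) (c : ℕ → E) (s : ℝ) :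
    HasDerivAt (taylorSum a (m + 1) c) (taylorSum a m (fun i => c (i + 1)) s) s := by
  have h : taylorSum a (m + 1) c = fun s => (∑ i ∈ Finset.range (m + 1),
      ((s - a) ^ (i + 1) / ((i + 1).factorial : ℝ)) • c (i + 1)) + c 0 := by
    funext s
    rw [taylorSum, Finset.sum_range_succ']
    simp
  rw [h]
  refine HasDerivAt.add_const _ (HasDerivAt.fun_sum fun i _ => HasDerivAt.smul_const ?_ _)
  have h1 := (((hasDerivAt_id s).sub_const a).pow (i + 1)).div_const ((i + 1).factorial : ℝ)
  refine h1.congr_deriv ?_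
  have : (i.factorial : ℝ) ≠ 0 := by positivity
  rw [Nat.factorial_succ]
  push_cast
  simp only [id, mul_one]
  field_simp

/-- The Taylor remainder of a `C^k` chain, with the top derivative `ω`-close to its initial value. -/
theorem taylor_remainder_le {k : ℕ} {Y : ℕ → ℝ → E} {a h ω : ℝ} (hh : 0 ≤ h)
    (hY : ∀ j < k, ∀ s ∈ Icc a (a + h), HasDerivWithinAt (Y j) (Y (j + 1) s) (Icc a (a + h)) s)
    (hω : ∀ s ∈ Icc a (a + h), ‖Y k s - Y k a‖ ≤ ω) :
    ∀ m j, j + m = k → ∀ s ∈ Icc a (a + h),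
      ‖Y j s - taylorSum a m (fun i => Y (j + i) a) s‖ ≤ ω * h ^ m := by
  intro m
  induction m with
  | zero =>
    intro j hj s hs
    obtain rfl : j = k := by omega
    simpa [taylorSum] using hω s hs
  | succ m ih =>
    intro j hj s hs
    have hd : ∀ x ∈ Icc a (a + h), HasDerivWithinAt
        (fun s => Y j s - taylorSum a (m + 1) (fun i => Y (j + i) a) s)
        (Y (j + 1) x - taylorSum a m (fun i => Y (j + 1 + i) a) x) (Icc a (a + h)) x := by
      intro x hx
      refine (hY j (by omega) x hx).sub ?_
      have := (hasDerivAt_taylorSum a m (fun i => Y (j + i) a) x).hasDerivWithinAt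
        (s := Icc a (a + h))
      simpa only [add_assoc, add_comm 1] using this
    have ha : a ∈ Icc a (a + h) := left_mem_Icc.2 (by linarith)
    have hω0 : 0 ≤ ω := (norm_nonneg _).trans (hω a ha)
    -- The derivative of the remainder is the remainder one order lower and the remainder vanishes
    -- at `a`; each integration costs a factor `h`, the factorial gain being discarded.
    have := norm_image_sub_le_of_norm_deriv_le_segment' hd
      (fun x hx => ih (j + 1) (by omega) x (Ico_subset_Icc_self hx)) s hs
    simp only [taylorSum_self, add_zero, sub_self, sub_zero] at this
    refine this.trans ?_
    rw [pow_succ, ← mul_assoc]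
    gcongr
    linarith [hs.2]

/-- The BDF-`k` operator is exact on polynomials of degree at most `k`. -/
theorem bdf_taylorSum {k : ℕ} (hk1 : 1 ≤ k) (hk5 : k ≤ 5) (a : ℝ) {τ : ℝ} (hτ : 0 < τ)
    (c : ℕ → E) :
    (1 / τ) • ∑ ℓ ∈ Finset.range (k + 1), bdfCoeff k ℓ • taylorSum a k c (a + ((k : ℝ) - ℓ) * τ)
      = taylorSum a (k - 1) (fun i => c (i + 1)) (a + k * τ) := by
  -- Expansion about the oldest node: the `ℓ`-th BDF node is at distance `(k - ℓ) τ`, so each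
  -- monomial is handled by one order condition.
  have h1 : ∀ i ∈ Finset.range (k + 1), (1 / τ) • ∑ ℓ ∈ Finset.range (k + 1), bdfCoeff k ℓ •
      ((a + ((k : ℝ) - ℓ) * τ - a) ^ i / (i.factorial : ℝ)) • c i
      = (1 / τ * (τ ^ i / (i.factorial : ℝ) * (i * (k : ℝ) ^ (i - 1)))) • c i := by
    intro i hi
    rw [← bdfCoeff_order hk1 hk5 (Nat.lt_succ_iff.1 (Finset.mem_range.1 hi))]
    simp only [smul_smul, ← Finset.sum_smul, Finset.mul_sum]
    congr 1
    refine Finset.sum_congr rfl fun ℓ _ => ?_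
    rw [add_sub_cancel_left, mul_pow]
    ring
  simp only [taylorSum, Finset.smul_sum] at h1 ⊢
  rw [Finset.sum_comm, Finset.sum_congr rfl h1, Finset.sum_range_succ',
    Nat.sub_add_cancel hk1]
  simp only [CharP.cast_eq_zero, zero_mul, mul_zero, zero_smul, add_zero]
  refine Finset.sum_congr rfl fun i _ => ?_
  congr 1
  have : (i.factorial : ℝ) ≠ 0 := by positivity
  rw [Nat.factorial_succ, add_sub_cancel_left, mul_pow, Nat.add_sub_cancel]
  push_cast
  field_simp
  ring

/-- The truncation error of the BDF-`k` operator. -/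
theorem bdf_truncation_le {k : ℕ} (hk1 : 1 ≤ k) (hk5 : k ≤ 5) {Y : ℕ → ℝ → E} {a τ ω : ℝ}
    (hτ : 0 < τ)
    (hY : ∀ j < k, ∀ s ∈ Icc a (a + k * τ),
      HasDerivWithinAt (Y j) (Y (j + 1) s) (Icc a (a + k * τ)) s)
    (hω : ∀ s ∈ Icc a (a + k * τ), ‖Y k s - Y k a‖ ≤ ω) :
    ‖(1 / τ) • ∑ ℓ ∈ Finset.range (k + 1), bdfCoeff k ℓ • Y 0 (a + ((k : ℝ) - ℓ) * τ)
        - Y 1 (a + k * τ)‖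
      ≤ ((∑ ℓ ∈ Finset.range (k + 1), |bdfCoeff k ℓ|) * (k : ℝ) ^ k + (k : ℝ) ^ (k - 1))
        * τ ^ (k - 1) * ω := by
  have hkτ : 0 ≤ k * τ := by positivity
  have h0 := taylor_remainder_le hkτ hY hω k 0 (by omega)
  have h1 := taylor_remainder_le hkτ hY hω (k - 1) 1 (by omega) (a + k * τ)
    (right_mem_Icc.2 (by linarith))
  simp only [zero_add] at h0
  have e1 : (fun i => Y (1 + i) a) = fun i => Y (i + 1) a := by
    funext i; rw [add_comm]
  rw [e1, ← bdf_taylorSum hk1 hk5 a hτ (fun i => Y i a)] at h1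
  -- Exactness on Taylor polynomials leaves only the remainders of `Y 0` at the nodes and of `Y 1`
  -- at the newest node.
  have e2 : (1 / τ) • ∑ ℓ ∈ Finset.range (k + 1), bdfCoeff k ℓ • Y 0 (a + ((k : ℝ) - ℓ) * τ)
        - Y 1 (a + k * τ)
      = (1 / τ) • ∑ ℓ ∈ Finset.range (k + 1), bdfCoeff k ℓ • (Y 0 (a + ((k : ℝ) - ℓ) * τ)
          - taylorSum a k (fun i => Y i a) (a + ((k : ℝ) - ℓ) * τ))
        - (Y 1 (a + k * τ) - (1 / τ) • ∑ ℓ ∈ Finset.range (k + 1),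
          bdfCoeff k ℓ • taylorSum a k (fun i => Y i a) (a + ((k : ℝ) - ℓ) * τ)) := by
    simp only [smul_sub, Finset.sum_sub_distrib]
    abel
  have h2 : ‖∑ ℓ ∈ Finset.range (k + 1), bdfCoeff k ℓ • (Y 0 (a + ((k : ℝ) - ℓ) * τ)
      - taylorSum a k (fun i => Y i a) (a + ((k : ℝ) - ℓ) * τ))‖
      ≤ (∑ ℓ ∈ Finset.range (k + 1), |bdfCoeff k ℓ|) * (ω * (k * τ) ^ k) := by
    rw [Finset.sum_mul]
    refine (norm_sum_le _ _).trans (Finset.sum_le_sum fun ℓ hℓ => ?_)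
    rw [norm_smul, Real.norm_eq_abs]
    have hℓk : (ℓ : ℝ) ≤ k := by exact_mod_cast Nat.lt_succ_iff.1 (Finset.mem_range.1 hℓ)
    have hℓ0 : (0 : ℝ) ≤ ℓ := by positivity
    gcongr
    refine h0 _ ⟨?_, ?_⟩
    · have : 0 ≤ ((k : ℝ) - ℓ) * τ := mul_nonneg (by linarith) hτ.le
      linarith
    · gcongr; linarith
  rw [e2]
  refine (norm_sub_le _ _).trans ?_
  rw [norm_smul, Real.norm_of_nonneg (by positivity : 0 ≤ 1 / τ)]
  have h3 := mul_le_mul_of_nonneg_left h2 (by positivity : 0 ≤ 1 / τ)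
  refine (add_le_add h3 h1).trans (le_of_eq ?_)
  obtain ⟨m, rfl⟩ : ∃ m, k = m + 1 := ⟨k - 1, by omega⟩
  simp only [Nat.add_sub_cancel, mul_pow]
  field_simp
  ring

end Truncation

/-! ### Square-integrable time derivatives from difference quotients. -/

section Regularity

open Filter Topology

/-- Cauchy–Schwarz, obtained by integrating `(‖x r‖ - c)² ≥ 0` with `c` the mean of `‖x‖`. -/
theorem norm_integral_sq_le {E : Type*} [NormedAddCommGroup E] [NormedSpace ℝ E] {x : ℝ → E}
    (hx : Continuous x) {s t : ℝ} (hst : s ≤ t) :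
    ‖∫ r in s..t, x r‖ ^ 2 ≤ (t - s) * ∫ r in s..t, ‖x r‖ ^ 2 := by
  rcases hst.eq_or_lt with rfl | hlt
  · simp
  have h1 := intervalIntegral.norm_integral_le_integral_norm (f := x) (μ := volume) hst
  set I := ∫ r in s..t, ‖x r‖ with hI
  have hpos : 0 < t - s := sub_pos.2 hlt
  set c := I / (t - s) with hc
  have h2 : ∫ r in s..t, (2 * c * ‖x r‖ - c ^ 2) ≤ ∫ r in s..t, ‖x r‖ ^ 2 := by
    refine intervalIntegral.integral_mono_on hst ?_ ?_ fun r _ => ?_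
    · exact (by fun_prop : Continuous fun r => 2 * c * ‖x r‖ - c ^ 2).intervalIntegrable _ _
    · exact (by fun_prop : Continuous fun r => ‖x r‖ ^ 2).intervalIntegrable _ _
    · nlinarith [sq_nonneg (‖x r‖ - c)]
  rw [intervalIntegral.integral_sub, intervalIntegral.integral_const_mul,
    intervalIntegral.integral_const, smul_eq_mul, ← hI] at h2
  · have h3 : c * (t - s) = I := by rw [hc]; field_simp
    have h4 : I ^ 2 = (t - s) * (2 * c * I - (t - s) * c ^ 2) := by
      rw [← h3]; ring
    calc ‖∫ r in s..t, x r‖ ^ 2 ≤ I ^ 2 := by gcongr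
      _ = (t - s) * (2 * c * I - (t - s) * c ^ 2) := h4
      _ ≤ _ := by gcongr
  · exact (by fun_prop : Continuous fun r => 2 * c * ‖x r‖).intervalIntegrable _ _
  · exact continuous_const.intervalIntegrable _ _

variable {Q H : Type*} [NormedAddCommGroup Q] [InnerProductSpace ℝ Q]
  [NormedAddCommGroup H] [InnerProductSpace ℝ H]

/-- The energy estimate for increments of the solution of `M (ι w)' + b w = G`. -/
theorem integral_norm_increment_sq_le
    (ι : Q →L[ℝ] H) (M : H →L[ℝ] H →L[ℝ] ℝ) (b : Q →L[ℝ] Q →L[ℝ] ℝ)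
    (hM : ∀ x y, M x y = M y x) (hM0 : ∀ x, 0 ≤ M x x)
    {cb : ℝ} (hcb : 0 < cb) (hbe : ∀ q, cb * ‖q‖ ^ 2 ≤ b q q)
    {T Λ : ℝ} {w : ℝ → Q} (hw : Continuous w) {v' : ℝ → H} {G : ℝ → Q →L[ℝ] ℝ}
    (hder : ∀ t ∈ Icc 0 T, HasDerivWithinAt (fun t => ι (w t)) (v' t) (Icc 0 T) t)
    (heq : ∀ t ∈ Icc 0 T, ∀ q, M (v' t) (ι q) + b (w t) q = G t q)
    (hv' : ∀ t ∈ Icc 0 T, ‖v' t‖ ≤ Λ)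
    (hG : ∀ s ∈ Icc 0 T, ∀ t ∈ Icc 0 T, ‖G t - G s‖ ≤ Λ * |t - s|)
    {h : ℝ} (h0 : 0 < h) (hT : h ≤ T) :
    ∫ r in (0 : ℝ)..(T - h), ‖w (r + h) - w r‖ ^ 2
      ≤ (‖M‖ * Λ ^ 2 + Λ ^ 2 / cb * T) / cb * h ^ 2 := by
  set z : ℝ → Q := fun t => w (t + h) - w t with hz
  have hzc : Continuous z := by fun_prop
  -- Testing the differenced equation with `z` bounds `(M (ι z) (ι z))'` by `-cb ‖z‖² + (Λ h)² /
  -- cb`; hence `Φ` is nonincreasing.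
  set Φ : ℝ → ℝ := fun t => M (ι (z t)) (ι (z t)) + cb * (∫ r in (0 : ℝ)..t, ‖z r‖ ^ 2)
    - (Λ * h) ^ 2 / cb * t with hΦ
  have hz2 : Continuous fun r => ‖z r‖ ^ 2 := by fun_prop
  have hΦc : Continuous Φ := by
    have : Continuous fun t => ∫ r in (0 : ℝ)..t, ‖z r‖ ^ 2 :=
      intervalIntegral.continuous_primitive (fun a b => hz2.intervalIntegrable a b) 0
    fun_prop
  have hd : ∀ t ∈ Ioo 0 (T - h), ∃ D ≤ (0 : ℝ), HasDerivAt Φ D t := by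
    intro t ht
    have ht1 : t ∈ Icc 0 T := ⟨ht.1.le, by linarith [ht.2]⟩
    have ht2 : t + h ∈ Icc 0 T := ⟨by linarith [ht.1], by linarith [ht.2]⟩
    have d1 : HasDerivAt (fun t => ι (w t)) (v' t) t :=
      (hder t ht1).hasDerivAt (Icc_mem_nhds ht.1 (by linarith [ht.2]))
    have d2 : HasDerivAt (fun t => ι (w t)) (v' (t + h)) (t + h) :=
      (hder _ ht2).hasDerivAt (Icc_mem_nhds (by linarith [ht.1]) (by linarith [ht.2]))
    have d3 : HasDerivAt (fun t => ι (z t)) (v' (t + h) - v' t) t := by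
      have := (d2.comp_add_const t h).sub d1
      refine this.congr_of_eventuallyEq (Eventually.of_forall fun r => ?_)
      simp [hz]
    have d4 := (M.hasFDerivAt.comp_hasDerivAt t d3).clm_apply d3
    have d5 := (hz2.integral_hasStrictDerivAt 0 t).hasDerivAt
    refine ⟨_, ?_, (d4.add (d5.const_mul cb)).sub ((hasDerivAt_id t).const_mul _)⟩
    simp only [Function.comp, hM (ι (z t)), mul_one]
    have e1 : M (v' (t + h) - v' t) (ι (z t)) = (G (t + h) - G t) (z t) - b (z t) (z t) := by
      have a1 := heq _ ht2 (z t)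
      have a2 := heq _ ht1 (z t)
      have a3 : b (z t) (z t) = b (w (t + h)) (z t) - b (w t) (z t) := by
        simp only [hz, map_sub, sub_apply]
        ring
      rw [a3]
      simp only [map_sub, sub_apply] at a1 a2 ⊢
      linarith
    have e2 := dual_apply_le (G (t + h) - G t) (z t) (half_pos hcb)
    have e3 := hbe (z t)
    have e4 : ‖G (t + h) - G t‖ ^ 2 / (4 * (cb / 2)) ≤ (Λ * h) ^ 2 / cb / 2 := by
      have := hG t ht1 (t + h) ht2
      rw [add_sub_cancel_left, abs_of_pos h0] at this
      rw [show 4 * (cb / 2) = cb * 2 by ring, ← div_div]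
      gcongr
    rw [e1]
    linarith
  have hanti : AntitoneOn Φ (Icc 0 (T - h)) := by
    refine antitoneOn_of_deriv_nonpos (convex_Icc _ _) hΦc.continuousOn ?_ ?_ <;>
      rw [interior_Icc]
    · intro t ht
      obtain ⟨D, _, hD⟩ := hd t ht
      exact hD.differentiableAt.differentiableWithinAt
    · intro t ht
      obtain ⟨D, hD0, hD⟩ := hd t ht
      rwa [hD.deriv]
  have hle := hanti (left_mem_Icc.2 (by linarith)) (right_mem_Icc.2 (by linarith))
    (by linarith : (0 : ℝ) ≤ T - h)
  simp only [hΦ, intervalIntegral.integral_same, mul_zero, add_zero, sub_zero] at hle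
  -- The initial increment is `O(h)` in `H` because `v'` is bounded up to `t = 0`; this takes the
  -- place of a compatibility condition.
  have hz0 : ‖ι (z 0)‖ ≤ Λ * h := by
    have := norm_image_sub_le_of_norm_deriv_le_segment' hder
      (fun x hx => hv' x (Ico_subset_Icc_self hx)) h ⟨h0.le, hT⟩
    simpa [hz] using this
  have h1 : M (ι (z 0)) (ι (z 0)) ≤ ‖M‖ * (Λ * h) ^ 2 := by
    refine (bilin_self_le M _).trans ?_
    gcongr
  have h2 := hM0 (ι (z (T - h)))
  have h3 : (Λ * h) ^ 2 / cb * (T - h) ≤ (Λ * h) ^ 2 / cb * T := by gcongr; linarith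
  rw [div_mul_eq_mul_div, le_div_iff₀ hcb]
  have h4 : (‖M‖ * Λ ^ 2 + Λ ^ 2 / cb * T) * h ^ 2 = ‖M‖ * (Λ * h) ^ 2 + (Λ * h) ^ 2 / cb * T := by
    ring
  rw [h4]
  linarith

/-- The integral is the difference of the integrals of `w` over `[t, t + h]` and `[s, s + h]`, whose
averages converge by continuity. -/
theorem tendsto_integral_difference_quotient [CompleteSpace Q] {w : ℝ → Q} (hw : Continuous w)
    (s t : ℝ) :
    Tendsto (fun h : ℝ => h⁻¹ • ∫ r in s..t, (w (r + h) - w r)) (𝓝[>] 0) (𝓝 (w t - w s)) := by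
  have hi : ∀ a b, IntervalIntegrable w volume a b := fun a b => hw.intervalIntegrable a b
  have hd : ∀ x, Tendsto (fun h : ℝ => h⁻¹ • ((∫ r in (0 : ℝ)..(x + h), w r)
      - ∫ r in (0 : ℝ)..x, w r)) (𝓝[>] 0) (𝓝 (w x)) := fun x =>
    (hw.integral_hasStrictDerivAt 0 x).hasDerivAt.tendsto_slope_zero_right
  refine ((hd t).sub (hd s)).congr fun h => ?_
  have hi' : IntervalIntegrable (fun r => w (r + h)) volume s t :=
    (by fun_prop : Continuous fun r => w (r + h)).intervalIntegrable _ _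
  rw [← smul_sub, intervalIntegral.integral_sub hi' (hi _ _),
    intervalIntegral.integral_comp_add_right, ← intervalIntegral.integral_interval_sub_left
      (hi 0 (t + h)) (hi 0 (s + h)), ← intervalIntegral.integral_interval_sub_left
      (hi 0 t) (hi 0 s)]
  congr 1
  abel

/-- `w` has a square integrable derivative, in the form of an estimate on its increments: the
monotone function `E` stands for `t ↦ ∫₀ᵗ ‖w'‖²`. -/
theorem exists_monotone_increment_bound [CompleteSpace Q]
    (ι : Q →L[ℝ] H) (M : H →L[ℝ] H →L[ℝ] ℝ) (b : Q →L[ℝ] Q →L[ℝ] ℝ)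
    (hM : ∀ x y, M x y = M y x) (hM0 : ∀ x, 0 ≤ M x x)
    {cb : ℝ} (hcb : 0 < cb) (hbe : ∀ q, cb * ‖q‖ ^ 2 ≤ b q q)
    {T Λ : ℝ} (hT : 0 < T) {w : ℝ → Q} (hw : Continuous w) {v' : ℝ → H} {G : ℝ → Q →L[ℝ] ℝ}
    (hder : ∀ t ∈ Icc 0 T, HasDerivWithinAt (fun t => ι (w t)) (v' t) (Icc 0 T) t)
    (heq : ∀ t ∈ Icc 0 T, ∀ q, M (v' t) (ι q) + b (w t) q = G t q)
    (hv' : ∀ t ∈ Icc 0 T, ‖v' t‖ ≤ Λ)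
    (hG : ∀ s ∈ Icc 0 T, ∀ t ∈ Icc 0 T, ‖G t - G s‖ ≤ Λ * |t - s|) :
    ∃ (E : ℝ → ℝ) (C : ℝ), 0 ≤ C ∧ (∀ t ∈ Icc 0 T, 0 ≤ E t ∧ E t ≤ C) ∧
      (∀ s ∈ Icc 0 T, ∀ t ∈ Icc 0 T, s ≤ t → E s ≤ E t) ∧
      ∀ s ∈ Icc 0 T, ∀ t ∈ Icc 0 T, s ≤ t → ‖w t - w s‖ ^ 2 ≤ (t - s) * (E t - E s) := by
  set C := (‖M‖ * Λ ^ 2 + Λ ^ 2 / cb * T) / cb with hC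
  have hC0 : 0 ≤ C := by positivity
  set z : ℝ → ℝ → Q := fun h r => h⁻¹ • (w (r + h) - w r) with hz
  have hzc : ∀ h, Continuous (z h) := fun h => by fun_prop
  have hz2 : ∀ h, Continuous fun r => ‖z h r‖ ^ 2 := fun h => by have := hzc h; fun_prop
  -- The cutoff at `T - h` keeps both arguments of the increment inside `[0, T]`.
  set F : ℝ → ℝ → ℝ := fun h t => ∫ r in (0 : ℝ)..(min t (T - h)), ‖z h r‖ ^ 2 with hF
  have hmono : ∀ h s t, s ≤ t → 0 ≤ t → h ≤ T → 0 ≤ s → F h s ≤ F h t := by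
    intro h s t hst _ hh hs
    refine intervalIntegral.integral_mono_interval le_rfl (le_min hs (by linarith))
      (min_le_min_right _ hst) (Eventually.of_forall fun r => sq_nonneg _)
      ((hz2 h).intervalIntegrable _ _)
  have hsmall : ∀ᶠ h in 𝓝[>] (0 : ℝ), 0 < h ∧ h ≤ T := by
    filter_upwards [Ioc_mem_nhdsGT hT] with h hh using hh
  have hbd : ∀ t ∈ Icc 0 T, ∀ᶠ h in 𝓝[>] (0 : ℝ), F h t ∈ Icc 0 C := by
    intro t ht
    filter_upwards [hsmall] with h hh
    refine ⟨intervalIntegral.integral_nonneg (le_min ht.1 (by linarith [hh.2]))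
      fun r _ => sq_nonneg _, (hmono h t T ht.2 hT.le hh.2 ht.1).trans ?_⟩
    have := integral_norm_increment_sq_le ι M b hM hM0 hcb hbe hw hder heq hv' hG hh.1 hh.2
    simp only [hF, hz, min_eq_right (show T - h ≤ T by linarith [hh.1]), norm_smul, mul_pow,
      intervalIntegral.integral_const_mul]
    rw [norm_inv, Real.norm_of_nonneg hh.1.le, inv_pow, inv_mul_le_iff₀ (pow_pos hh.1 2)]
    linarith
  -- Along one ultrafilter the bounded quantities `F h t` converge for all `t` simultaneously, so no
  -- subsequence has to be selected.
  set U : Ultrafilter ℝ := Ultrafilter.of (𝓝[>] (0 : ℝ)) with hU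
  have hUle : (U : Filter ℝ) ≤ 𝓝[>] 0 := Ultrafilter.of_le _
  have hlim : ∀ t, ∃ x, t ∈ Icc 0 T → Tendsto (fun h => F h t) U (𝓝 x) ∧ x ∈ Icc 0 C := by
    intro t
    by_cases ht : t ∈ Icc 0 T
    · obtain ⟨x, hx, hle⟩ := isCompact_Icc.ultrafilter_le_nhds (U.map fun h => F h t)
        (le_principal_iff.2 (hUle (hbd t ht)))
      exact ⟨x, fun _ => ⟨hle, hx⟩⟩
    · exact ⟨0, fun h => absurd h ht⟩
  choose E hE using hlim
  have hEmono : ∀ s ∈ Icc 0 T, ∀ t ∈ Icc 0 T, s ≤ t → E s ≤ E t := by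
    intro s hs t ht hst
    refine le_of_tendsto_of_tendsto (hE s hs).1 (hE t ht).1 (hUle ?_)
    filter_upwards [hsmall] with h hh using hmono h s t hst ht.1 hh.2 hs.1
  have hlt : ∀ s ∈ Icc 0 T, ∀ t ∈ Icc 0 T, s ≤ t → t < T →
      ‖w t - w s‖ ^ 2 ≤ (t - s) * (E t - E s) := by
    intro s hs t ht hst htT
    refine le_of_tendsto_of_tendsto
      (((tendsto_integral_difference_quotient hw s t).mono_left hUle).norm.pow 2)
      (((hE t ht).1.sub (hE s hs).1).const_mul (t - s)) (hUle ?_)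
    filter_upwards [Ioc_mem_nhdsGT (sub_pos.2 htT)] with h hh
    have hh2 := hh.2
    have e : F h t - F h s = ∫ r in s..t, ‖z h r‖ ^ 2 := by
      simp only [hF, min_eq_left (show t ≤ T - h by linarith),
        min_eq_left (show s ≤ T - h by linarith)]
      exact intervalIntegral.integral_interval_sub_left ((hz2 h).intervalIntegrable _ _)
        ((hz2 h).intervalIntegrable _ _)
    rw [e, ← intervalIntegral.integral_smul]
    exact norm_integral_sq_le (hzc h) hst
  refine ⟨E, C, hC0, fun t ht => (hE t ht).2, hEmono, fun s hs t ht hst => ?_⟩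
  -- At `t = T` no positive shift stays in the interval; the bound follows from left limits and
  -- monotonicity of `E`.
  rcases ht.2.lt_or_eq with htT | rfl
  · exact hlt s hs t ht hst htT
  rcases hst.lt_or_eq with hsT | rfl
  · have h1 : Tendsto (fun r => ‖w r - w s‖ ^ 2) (𝓝[<] t) (𝓝 (‖w t - w s‖ ^ 2)) :=
      ((by fun_prop : Continuous fun r => ‖w r - w s‖ ^ 2).tendsto t).mono_left nhdsWithin_le_nhds
    have h2 : Tendsto (fun r => (r - s) * (E t - E s)) (𝓝[<] t) (𝓝 ((t - s) * (E t - E s))) :=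
      ((by fun_prop : Continuous fun r => (r - s) * (E t - E s)).tendsto t).mono_left
        nhdsWithin_le_nhds
    refine le_of_tendsto_of_tendsto h1 h2 ?_
    filter_upwards [Ioo_mem_nhdsLT hsT] with r hr
    have hrI : r ∈ Icc 0 t := ⟨hs.1.trans hr.1.le, hr.2.le⟩
    refine (hlt s hs r hrI hr.1.le hr.2).trans ?_
    have := hEmono r hrI t ht hr.2.le
    exact mul_le_mul_of_nonneg_left (by linarith) (by linarith [hr.1])
  · simp

end Regularity

/-! ### Lax–Milgram, iterated derivatives and summed truncation errors. -/

theorem eq_of_elliptic {Q : Type*} [NormedAddCommGroup Q] [InnerProductSpace ℝ Q]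
    (b : Q →L[ℝ] Q →L[ℝ] ℝ) {cb : ℝ} (hcb : 0 < cb) (hbe : ∀ q, cb * ‖q‖ ^ 2 ≤ b q q)
    {x y : Q} (h : b x = b y) : x = y := by
  have h1 := hbe (x - y)
  rw [map_sub b, h, sub_self, zero_apply] at h1
  have h2 : ‖x - y‖ ^ 2 ≤ 0 := by nlinarith [sq_nonneg ‖x - y‖]
  have h3 : ‖x - y‖ = 0 := by simpa using le_antisymm h2 (sq_nonneg _)
  exact sub_eq_zero.1 (norm_eq_zero.1 h3)

/-- Lax–Milgram packaged as a bounded linear operator, so that composing with it preserves `C^k`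
regularity of curves; linearity follows from uniqueness and the bound `1 / cb` from testing with the
solution. -/
theorem exists_bilin_rightInverse {Q : Type*} [NormedAddCommGroup Q] [InnerProductSpace ℝ Q]
    [CompleteSpace Q] (b : Q →L[ℝ] Q →L[ℝ] ℝ) {cb : ℝ} (hcb : 0 < cb)
    (hbe : ∀ q, cb * ‖q‖ ^ 2 ≤ b q q) :
    ∃ R : (Q →L[ℝ] ℝ) →L[ℝ] Q, ∀ ρ, b (R ρ) = ρ := by
  have hco : IsCoercive b := ⟨cb, hcb, fun q => by
    have := hbe q
    rwa [sq, ← mul_assoc] at this⟩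
  have hsurj : ∀ ρ : Q →L[ℝ] ℝ, ∃ x, b x = ρ := by
    intro ρ
    refine ⟨hco.continuousLinearEquivOfBilin.symm ((InnerProductSpace.toDual ℝ Q).symm ρ), ?_⟩
    ext q
    rw [← hco.continuousLinearEquivOfBilin_apply, ContinuousLinearEquiv.apply_symm_apply,
      InnerProductSpace.toDual_symm_apply]
  choose r hr using hsurj
  refine ⟨LinearMap.mkContinuous
    { toFun := r
      map_add' := fun x y => eq_of_elliptic b hcb hbe (by simp [hr])
      map_smul' := fun c x => eq_of_elliptic b hcb hbe (by simp [hr]) } (1 / cb) fun ρ => ?_, fun ρ => ?_⟩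
  · have h1 := hbe (r ρ)
    rw [hr] at h1
    have h2 := (le_abs_self _).trans (ρ.le_opNorm (r ρ))
    change ‖r ρ‖ ≤ 1 / cb * ‖ρ‖
    rw [one_div, ← div_eq_inv_mul, le_div_iff₀ hcb]
    rcases (norm_nonneg (r ρ)).eq_or_lt with h0 | h0
    · rw [← h0]; simp
    · exact le_of_mul_le_mul_right (by linarith [sq ‖r ρ‖, mul_assoc cb ‖r ρ‖ ‖r ρ‖]) h0
  · exact hr ρ

section IteratedDeriv

variable {E F : Type*} [NormedAddCommGroup E] [NormedSpace ℝ E]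
  [NormedAddCommGroup F] [NormedSpace ℝ F]

theorem iteratedDerivWithin_clm_comp {I : Set ℝ} (hI : UniqueDiffOn ℝ I) (A : E →L[ℝ] F)
    {x : ℝ → E} {n : WithTop ℕ∞} (hx : ContDiffOn ℝ n x I) {j : ℕ} (hj : (j : WithTop ℕ∞) ≤ n)
    {t : ℝ} (ht : t ∈ I) :
    iteratedDerivWithin j (fun s => A (x s)) I t = A (iteratedDerivWithin j x I t) := by
  have h := A.iteratedFDerivWithin_comp_left (hx t ht) hI ht hj
  simp only [iteratedDerivWithin]
  change iteratedFDerivWithin ℝ j (A ∘ x) I t _ = _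
  rw [h]
  rfl

theorem hasDerivWithinAt_iteratedDerivWithin {I : Set ℝ} (hI : UniqueDiffOn ℝ I)
    {x : ℝ → E} {n : WithTop ℕ∞} (hx : ContDiffOn ℝ n x I) {j : ℕ} (hj : (j : WithTop ℕ∞) < n)
    {t : ℝ} (ht : t ∈ I) :
    HasDerivWithinAt (iteratedDerivWithin j x I) (iteratedDerivWithin (j + 1) x I t) I t := by
  rw [iteratedDerivWithin_succ]
  exact (hx.differentiableOn_iteratedDerivWithin hj hI t ht).hasDerivWithinAt

theorem exists_lipschitz_of_contDiffOn_one {T : ℝ} (hT : 0 < T) {x : ℝ → E}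
    (hx : ContDiffOn ℝ 1 x (Icc 0 T)) :
    ∃ Λ, 0 ≤ Λ ∧ ∀ s ∈ Icc 0 T, ∀ t ∈ Icc 0 T, ‖x t - x s‖ ≤ Λ * |t - s| := by
  have hI := uniqueDiffOn_Icc hT
  obtain ⟨Λ, hΛ⟩ := isCompact_Icc.exists_bound_of_continuousOn
    (hx.continuousOn_derivWithin hI le_rfl)
  refine ⟨Λ, (norm_nonneg _).trans (hΛ 0 (left_mem_Icc.2 hT.le)), fun s hs t ht => ?_⟩
  exact (convex_Icc 0 T).norm_image_sub_le_of_norm_derivWithin_le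
    (hx.differentiableOn one_ne_zero) hΛ hs ht

end IteratedDeriv

/-- Telescoping with stride `k`: only the last `k` values minus the first `k` survive. This accounts
for the overlap of the BDF stencils. -/
theorem sum_Icc_sub_shift_le {k N : ℕ} (F : ℕ → ℝ) {C : ℝ} (hF : ∀ n ≤ N, 0 ≤ F n ∧ F n ≤ C) :
    ∑ n ∈ Finset.Icc k N, (F n - F (n - k)) ≤ k * C := by
  rcases lt_or_ge N k with h | h
  · rw [Finset.Icc_eq_empty (by omega), Finset.sum_empty]
    exact mul_nonneg (by positivity) ((hF 0 (by omega)).1.trans (hF 0 (by omega)).2)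
  have h1 : Finset.Icc k N = Finset.Ico k (N + 1) := by ext; simp
  rw [h1, Finset.sum_Ico_eq_sum_range]
  simp only [Nat.add_sub_cancel_left, Finset.sum_sub_distrib]
  have h2 := Finset.sum_range_add F k (N + 1 - k)
  rw [add_comm k, Finset.sum_range_add F (N + 1 - k) k] at h2
  have h3 : 0 ≤ ∑ i ∈ Finset.range k, F i :=
    Finset.sum_nonneg fun i hi => (hF i (by have := Finset.mem_range.1 hi; omega)).1
  have h4 : ∑ i ∈ Finset.range k, F (N + 1 - k + i) ≤ k * C := by
    have := Finset.sum_le_card_nsmul (Finset.range k) (fun i => F (N + 1 - k + i)) C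
      fun i hi => (hF _ (by have := Finset.mem_range.1 hi; omega)).2
    simpa using this
  linarith

/-- The accumulated truncation error of the BDF-`k` operator. -/
theorem exists_bdf_truncation_sum_le {E : Type*} [NormedAddCommGroup E] [NormedSpace ℝ E]
    {k : ℕ} (hk1 : 1 ≤ k) (hk5 : k ≤ 5) {T : ℝ} (hT : 0 < T) {y : ℝ → E}
    (hy : ContDiffOn ℝ (k : WithTop ℕ∞) y (Icc 0 T)) {F : ℝ → ℝ} {C : ℝ}
    (hF : ∀ t ∈ Icc 0 T, 0 ≤ F t ∧ F t ≤ C)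
    (hmono : ∀ s ∈ Icc 0 T, ∀ t ∈ Icc 0 T, s ≤ t → F s ≤ F t)
    (hinc : ∀ s ∈ Icc 0 T, ∀ t ∈ Icc 0 T, s ≤ t →
      ‖iteratedDerivWithin k y (Icc 0 T) t - iteratedDerivWithin k y (Icc 0 T) s‖ ^ 2
        ≤ (t - s) * (F t - F s)) :
    ∃ R, 0 ≤ R ∧ ∀ (τ : ℝ) (N : ℕ), 0 < τ → N * τ ≤ T →
      τ * ∑ n ∈ Finset.Icc k N, ‖(1 / τ) • ∑ ℓ ∈ Finset.range (k + 1),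
          bdfCoeff k ℓ • y ((n - ℓ : ℕ) * τ) - derivWithin y (Icc 0 T) (n * τ)‖ ^ 2
        ≤ R * τ ^ (2 * k) := by
  set c := (∑ ℓ ∈ Finset.range (k + 1), |bdfCoeff k ℓ|) * (k : ℝ) ^ k + (k : ℝ) ^ (k - 1) with hc
  have hI := uniqueDiffOn_Icc hT
  have hC : 0 ≤ C := by
    have := hF 0 (left_mem_Icc.2 hT.le)
    linarith
  refine ⟨c ^ 2 * k * (k * C), by positivity, fun τ N hτ hN => ?_⟩
  have hmem : ∀ n : ℕ, n ≤ N → (n : ℝ) * τ ∈ Icc 0 T := fun n hn =>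
    ⟨by positivity, le_trans (by gcongr) hN⟩
  have hterm : ∀ n ∈ Finset.Icc k N, ‖(1 / τ) • ∑ ℓ ∈ Finset.range (k + 1),
      bdfCoeff k ℓ • y ((n - ℓ : ℕ) * τ) - derivWithin y (Icc 0 T) (n * τ)‖ ^ 2
      ≤ (c * τ ^ (k - 1)) ^ 2 * (k * τ) * (F (n * τ) - F ((n - k : ℕ) * τ)) := by
    intro n hn
    obtain ⟨hkn, hnN⟩ := Finset.mem_Icc.1 hn
    have ha := hmem (n - k) (by omega)
    have hb := hmem n hnN
    have hab : ((n - k : ℕ) : ℝ) * τ + k * τ = n * τ := by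
      rw [Nat.cast_sub hkn]; ring
    set a := ((n - k : ℕ) : ℝ) * τ with ha'
    have hsub : Icc a (a + k * τ) ⊆ Icc 0 T := by
      rw [hab]; exact Icc_subset_Icc ha.1 hb.2
    have hFd : 0 ≤ F (n * τ) - F a :=
      sub_nonneg.2 (hmono _ ha _ hb (by rw [← hab]; have : 0 ≤ k * τ := by positivity
                                        linarith))
    -- This `ω` is of size `τ^{1/2}` times the root of the increment of `F` over the stencil.
    -- Squared, multiplied by `τ` and summed, it supplies the two powers of `τ` missing from
    -- `τ^{2(k-1)}`.
    have h := bdf_truncation_le hk1 hk5 (Y := fun j => iteratedDerivWithin j y (Icc 0 T)) (a := a)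
      (ω := Real.sqrt (k * τ * (F (n * τ) - F a))) hτ
      (fun j hj s hs => (hasDerivWithinAt_iteratedDerivWithin hI hy (by exact_mod_cast hj)
        (hsub hs)).mono hsub)
      (fun s hs => by
        refine Real.le_sqrt_of_sq_le ((hinc a ha s (hsub hs) hs.1).trans ?_)
        have h1 := hmono a ha s (hsub hs) hs.1
        have h2 := hmono s (hsub hs) _ hb (by rw [← hab]; exact hs.2)
        have h3 := hs.1
        have h4 := hs.2
        gcongr
        linarith)
    simp only [iteratedDerivWithin_zero, iteratedDerivWithin_one, hab] at h
    have e : ∑ ℓ ∈ Finset.range (k + 1), bdfCoeff k ℓ • y (a + ((k : ℝ) - ℓ) * τ)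
        = ∑ ℓ ∈ Finset.range (k + 1), bdfCoeff k ℓ • y ((n - ℓ : ℕ) * τ) := by
      refine Finset.sum_congr rfl fun ℓ hℓ => ?_
      have := Finset.mem_range.1 hℓ
      rw [ha', Nat.cast_sub hkn, Nat.cast_sub (by omega)]
      congr 2
      ring
    rw [e] at h
    calc _ ≤ (c * τ ^ (k - 1) * Real.sqrt (k * τ * (F (n * τ) - F a))) ^ 2 := by gcongr
      _ = _ := by
        rw [mul_pow, Real.sq_sqrt (by positivity)]; ring
  calc _ ≤ τ * ∑ n ∈ Finset.Icc k N,
        (c * τ ^ (k - 1)) ^ 2 * (k * τ) * (F (n * τ) - F ((n - k : ℕ) * τ)) := by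
        gcongr with n hn
        exact hterm n hn
    _ = τ * ((c * τ ^ (k - 1)) ^ 2 * (k * τ)) *
        ∑ n ∈ Finset.Icc k N, (F (n * τ) - F ((n - k : ℕ) * τ)) := by
        rw [← Finset.mul_sum]; ring
    _ ≤ τ * ((c * τ ^ (k - 1)) ^ 2 * (k * τ)) * (k * C) := by
        gcongr
        exact sum_Icc_sub_shift_le (fun n => F (n * τ)) fun n hn => hF _ (hmem n hn)
    _ = _ := by
        obtain ⟨m, rfl⟩ : ∃ m, k = m + 1 := ⟨k - 1, by omega⟩
        simp only [Nat.add_sub_cancel]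
        ring

/-! ### Reduction to the pressure and regularity of the exact solution. -/

namespace EllipticParabolicData

variable {V Q H : Type*}
  [NormedAddCommGroup V] [InnerProductSpace ℝ V]
  [NormedAddCommGroup Q] [InnerProductSpace ℝ Q]
  [NormedAddCommGroup H] [InnerProductSpace ℝ H]

/-- `v ↦ d(v, ι ·)` as a map into the dual of `Q`. -/
noncomputable def dDual (S : EllipticParabolicData V Q H) : V →L[ℝ] Q →L[ℝ] ℝ :=
  ((ContinuousLinearMap.compL ℝ Q H ℝ).flip S.ι).comp S.d

/-- `p ↦ c(p, ι ·)` as a map into the dual of `Q`. -/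
noncomputable def cDual (S : EllipticParabolicData V Q H) : H →L[ℝ] Q →L[ℝ] ℝ :=
  ((ContinuousLinearMap.compL ℝ Q H ℝ).flip S.ι).comp S.c

@[simp]
theorem dDual_apply (S : EllipticParabolicData V Q H) (v : V) (q : Q) :
    S.dDual v q = S.d v (S.ι q) := rfl

@[simp]
theorem cDual_apply (S : EllipticParabolicData V Q H) (p : H) (q : Q) :
    S.cDual p q = S.c p (S.ι q) := rfl

/-- The solution operator of the elliptic equation. -/
theorem exists_elliptic_solution [CompleteSpace V] (S : EllipticParabolicData V Q H) :
    ∃ (R : (V →L[ℝ] ℝ) →L[ℝ] V) (D : H →L[ℝ] V), (∀ h v, S.a (D h) v = S.d v h) ∧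
      ∀ (f : V →L[ℝ] ℝ) (u : V) (p : H), (∀ v, S.a u v - S.d v p = f v) → u = D p + R f := by
  obtain ⟨R, hR⟩ := exists_bilin_rightInverse S.a S.ca_pos S.a_elliptic
  refine ⟨R, R.comp S.d.flip, fun h v => by simp [hR], fun f u p h => ?_⟩
  refine eq_of_elliptic S.a S.ca_pos S.a_elliptic ?_
  ext v
  have := h v
  simp only [map_add, hR, add_apply, ContinuousLinearMap.comp_apply,
    ContinuousLinearMap.flip_apply]
  linarith

/-- The reduced form `c + d(D ·, ·)` of the parabolic equation. -/
theorem reduced_form_properties [CompleteSpace V] (S : EllipticParabolicData V Q H)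
    {D : H →L[ℝ] V} (hD : ∀ h v, S.a (D h) v = S.d v h) :
    (∀ x y, (S.c + S.d.comp D) x y = (S.c + S.d.comp D) y x) ∧
      ∀ x, S.cc * ‖x‖ ^ 2 ≤ (S.c + S.d.comp D) x x := by
  refine ⟨fun x y => ?_, fun x => ?_⟩
  · simp only [add_apply, ContinuousLinearMap.comp_apply, ← hD, S.c_symm x y,
      S.a_symm (D x) (D y)]
  · simp only [add_apply, ContinuousLinearMap.comp_apply, ← hD]
    have h1 := S.c_elliptic x
    have h2 := S.a_elliptic (D x)
    have h3 : 0 ≤ S.ca * ‖D x‖ ^ 2 := mul_nonneg S.ca_pos.le (sq_nonneg _)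
    linarith

/-- The two equations hold at every time point of a `C¹` solution, with the pressure a continuous
curve in `Q`. -/
theorem IsSolution.forall_mem [CompleteSpace Q] {S : EllipticParabolicData V Q H} {k : ℕ}
    {T : ℝ} {f : ℝ → V →L[ℝ] ℝ} {g : ℝ → Q →L[ℝ] ℝ} {u : ℝ → V} {p : ℝ → H}
    (hk : 1 ≤ k) (hT : 0 < T) (hf : ContinuousOn f (Icc 0 T))
    (hg : ContDiffOn ℝ (k : WithTop ℕ∞) g (Icc 0 T))
    (hu : ContDiffOn ℝ (k : WithTop ℕ∞) u (Icc 0 T))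
    (hp : ContDiffOn ℝ (k : WithTop ℕ∞) p (Icc 0 T)) (hs : S.IsSolution T f g u p) :
    (∀ t ∈ Icc 0 T, ∀ v, S.a (u t) v - S.d v (p t) = f t v) ∧
    ∃ pQ : ℝ → Q, ContDiffOn ℝ ((k - 1 : ℕ) : WithTop ℕ∞) pQ (Icc 0 T) ∧
      (∀ t ∈ Icc 0 T, S.ι (pQ t) = p t) ∧
      ∀ t, S.b (pQ t) = g t - derivWithin (fun s => S.dDual (u s) + S.cDual (p s)) (Icc 0 T) t := by
  have hI := uniqueDiffOn_Icc hT
  set y : ℝ → Q →L[ℝ] ℝ := fun s => S.dDual (u s) + S.cDual (p s) with hy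
  have hyC : ContDiffOn ℝ (k : WithTop ℕ∞) y (Icc 0 T) :=
    (hu.continuousLinearMap_comp S.dDual).add (hp.continuousLinearMap_comp S.cDual)
  have hk' : (k : WithTop ℕ∞) ≠ 0 := by exact_mod_cast (by omega : k ≠ 0)
  constructor
  · have h1 : EqOn (fun t => S.a (u t)) (fun t => f t + S.d.flip (p t)) (Icc 0 T) := by
      refine Measure.eqOn_Icc_of_ae_eq volume hT.ne ?_ ?_ ?_
      · filter_upwards [hs] with t ht
        ext v
        have := ht.1 v
        simp only [add_apply, ContinuousLinearMap.flip_apply]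
        linarith
      · exact S.a.continuous.comp_continuousOn hu.continuousOn
      · exact hf.add (S.d.flip.continuous.comp_continuousOn hp.continuousOn)
    intro t ht v
    have := congrArg (fun A => A v) (h1 ht)
    simp only [add_apply, ContinuousLinearMap.flip_apply] at this
    linarith
  -- The pressure in `Q` is defined by solving the second equation for `b`. This curve is `C^{k-1}`
  -- in `Q`, agrees almost everywhere with the given pressure, and hence everywhere after embedding
  -- into `H`.
  obtain ⟨R, hR⟩ := exists_bilin_rightInverse S.b S.cb_pos S.b_elliptic
  have hpQ : ContDiffOn ℝ ((k - 1 : ℕ) : WithTop ℕ∞) (fun t => R (g t - derivWithin y (Icc 0 T) t))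
      (Icc 0 T) :=
    ((hg.of_le (by exact_mod_cast Nat.sub_le k 1)).sub (hyC.derivWithin hI
      (by exact_mod_cast (by omega : k - 1 + 1 ≤ k)))).continuousLinearMap_comp R
  refine ⟨fun t => R (g t - derivWithin y (Icc 0 T) t), hpQ, ?_, fun t => hR _⟩
  refine Measure.eqOn_Icc_of_ae_eq volume hT.ne ?_
    (S.ι.continuous.comp_continuousOn hpQ.continuousOn) hp.continuousOn
  filter_upwards [hs, ae_restrict_mem measurableSet_Icc] with t ht htI
  obtain ⟨q, hq, hqe⟩ := ht.2
  have hd : derivWithin y (Icc 0 T) t =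
      S.dDual (derivWithin u (Icc 0 T) t) + S.cDual (derivWithin p (Icc 0 T) t) := by
    refine HasDerivWithinAt.derivWithin ?_ (hI t htI)
    exact (S.dDual.hasFDerivAt.comp_hasDerivWithinAt t
      (hu.differentiableOn hk' t htI).hasDerivWithinAt).add
      (S.cDual.hasFDerivAt.comp_hasDerivWithinAt t
      (hp.differentiableOn hk' t htI).hasDerivWithinAt)
  have hbq : S.b (R (g t - derivWithin y (Icc 0 T) t)) = S.b q := by
    rw [hR, hd]
    ext z
    have := hqe z
    simp only [sub_apply, add_apply, dDual_apply, cDual_apply]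
    linarith
  rw [eq_of_elliptic S.b S.cb_pos S.b_elliptic hbq, hq]

/-- Parabolic regularity: the `(k+1)`-st derivative of `d(u, ·) + c(p, ·)` exists as a square
integrable function with values in the dual of `Q`, in the form of an estimate on increments. -/
theorem exists_increment_bound [CompleteSpace V] [CompleteSpace Q]
    (S : EllipticParabolicData V Q H) {m : ℕ} {T : ℝ} {f : ℝ → V →L[ℝ] ℝ} {g : ℝ → Q →L[ℝ] ℝ}
    {u : ℝ → V} {p : ℝ → H} (hT : 0 < T)
    {R : (V →L[ℝ] ℝ) →L[ℝ] V} {D : H →L[ℝ] V} (hDa : ∀ h v, S.a (D h) v = S.d v h)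
    (hDR : ∀ (f : V →L[ℝ] ℝ) (u : V) (p : H), (∀ v, S.a u v - S.d v p = f v) → u = D p + R f)
    (hf : ContDiffOn ℝ ((m + 1 + 1 : ℕ) : WithTop ℕ∞) f (Icc 0 T))
    (hg : ContDiffOn ℝ ((m + 1 : ℕ) : WithTop ℕ∞) g (Icc 0 T))
    (hp : ContDiffOn ℝ ((m + 1 : ℕ) : WithTop ℕ∞) p (Icc 0 T))
    (hell : ∀ t ∈ Icc 0 T, ∀ v, S.a (u t) v - S.d v (p t) = f t v)
    {pQ : ℝ → Q} (hpQ : ContDiffOn ℝ (m : WithTop ℕ∞) pQ (Icc 0 T))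
    (hι : ∀ t ∈ Icc 0 T, S.ι (pQ t) = p t) {y : ℝ → Q →L[ℝ] ℝ}
    (hy : ∀ t, y t = S.dDual (u t) + S.cDual (p t))
    (hyC : ContDiffOn ℝ ((m + 1 : ℕ) : WithTop ℕ∞) y (Icc 0 T))
    (hb : ∀ t, S.b (pQ t) = g t - derivWithin y (Icc 0 T) t) :
    ∃ (F : ℝ → ℝ) (C : ℝ), (∀ t ∈ Icc 0 T, 0 ≤ F t ∧ F t ≤ C) ∧
      (∀ s ∈ Icc 0 T, ∀ t ∈ Icc 0 T, s ≤ t → F s ≤ F t) ∧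
      ∀ s ∈ Icc 0 T, ∀ t ∈ Icc 0 T, s ≤ t →
        ‖iteratedDerivWithin (m + 1) y (Icc 0 T) t - iteratedDerivWithin (m + 1) y (Icc 0 T) s‖ ^ 2
          ≤ (t - s) * (F t - F s) := by
  have hI : UniqueDiffOn ℝ (Icc 0 T) := uniqueDiffOn_Icc hT
  have hmm : (m : WithTop ℕ∞) ≤ ((m + 1 : ℕ) : WithTop ℕ∞) := by exact_mod_cast Nat.le_succ m
  have hml : (m : WithTop ℕ∞) < ((m + 1 : ℕ) : WithTop ℕ∞) := by exact_mod_cast Nat.lt_succ_self m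
  set M := S.c + S.d.comp D with hMdef
  obtain ⟨hMs, hMe⟩ := S.reduced_form_properties hDa
  have hM0 : ∀ x, 0 ≤ M x x := fun x =>
    (mul_nonneg S.cc_pos.le (sq_nonneg _)).trans (hMe x)
  -- the reduced representation of `y`
  set A : H →L[ℝ] Q →L[ℝ] ℝ := S.dDual.comp D + S.cDual with hA
  set φ : ℝ → Q →L[ℝ] ℝ := fun t => S.dDual (R (f t)) with hφ
  have hφC : ContDiffOn ℝ ((m + 1 + 1 : ℕ) : WithTop ℕ∞) φ (Icc 0 T) :=
    (hf.continuousLinearMap_comp R).continuousLinearMap_comp S.dDual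
  have hφC' : ContDiffOn ℝ ((m + 1 : ℕ) : WithTop ℕ∞) φ (Icc 0 T) :=
    hφC.of_le (by exact_mod_cast Nat.le_succ (m + 1))
  have hyeq : EqOn y (fun t => A (p t) + φ t) (Icc 0 T) := by
    intro t ht
    simp only [hy, hA, hφ, add_apply, ContinuousLinearMap.comp_apply]
    rw [hDR (f t) (u t) (p t) (hell t ht), map_add]
    abel
  have hyk : ∀ t ∈ (Icc 0 T), iteratedDerivWithin (m + 1) y (Icc 0 T) t
      = A (iteratedDerivWithin (m + 1) p (Icc 0 T) t) + iteratedDerivWithin (m + 1) φ (Icc 0 T) t := by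
    intro t ht
    have hAp : ContDiffOn ℝ ((m + 1 : ℕ) : WithTop ℕ∞) (fun t => A (p t)) (Icc 0 T) :=
      hp.continuousLinearMap_comp A
    rw [iteratedDerivWithin_congr hyeq ht, iteratedDerivWithin_fun_add ht hI
      (hAp t ht) (hφC' t ht), iteratedDerivWithin_clm_comp hI A hp le_rfl ht]
  -- the differentiated equation
  set w := iteratedDerivWithin m pQ (Icc 0 T) with hw
  have hwC : ContinuousOn w (Icc 0 T) := hpQ.continuousOn_iteratedDerivWithin le_rfl hI
  have hbw : ∀ t ∈ (Icc 0 T), S.b (w t)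
      = iteratedDerivWithin m g (Icc 0 T) t - iteratedDerivWithin (m + 1) y (Icc 0 T) t := by
    intro t ht
    have hy' : ContDiffOn ℝ (m : WithTop ℕ∞) (derivWithin y (Icc 0 T)) (Icc 0 T) :=
      hyC.derivWithin hI (by exact_mod_cast le_rfl)
    rw [hw, ← iteratedDerivWithin_clm_comp hI S.b hpQ le_rfl ht, iteratedDerivWithin_succ',
      ← iteratedDerivWithin_sub ht hI ((hg.of_le hmm) t ht) (hy' t ht)]
    exact iteratedDerivWithin_congr (fun s _ => hb s) ht
  have hιw : EqOn (fun t => S.ι (w t)) (iteratedDerivWithin m p (Icc 0 T)) (Icc 0 T) := by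
    intro t ht
    simp only [hw]
    rw [← iteratedDerivWithin_clm_comp hI S.ι hpQ le_rfl ht]
    exact iteratedDerivWithin_congr hι ht
  have hg1 : ContDiffOn ℝ 1 (iteratedDerivWithin m g (Icc 0 T)) (Icc 0 T) :=
    ((contDiffOn_nat_succ_iff_contDiffOn_one_iteratedDerivWithin hI).1 hg).2
  have hφ1 : ContDiffOn ℝ 1 (iteratedDerivWithin (m + 1) φ (Icc 0 T)) (Icc 0 T) :=
    ((contDiffOn_nat_succ_iff_contDiffOn_one_iteratedDerivWithin hI).1 hφC).2
  obtain ⟨Λ1, hΛ1, hL1⟩ := exists_lipschitz_of_contDiffOn_one hT hg1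
  obtain ⟨Λ2, hΛ2, hL2⟩ := exists_lipschitz_of_contDiffOn_one hT hφ1
  obtain ⟨Λ3, hL3⟩ := isCompact_Icc.exists_bound_of_continuousOn
    (hp.continuousOn_iteratedDerivWithin le_rfl hI)
  have hΛ3 : 0 ≤ Λ3 := (norm_nonneg _).trans (hL3 0 (left_mem_Icc.2 hT.le))
  -- Constant extension beyond `[0, T]`, so that shifted increments are defined and continuous on
  -- the whole line.
  set wc : ℝ → Q := fun t => w (projIcc 0 T hT.le t) with hwc
  have hwcC : Continuous wc :=
    hwC.comp_continuous (continuous_subtype_val.comp continuous_projIcc) fun t => (projIcc 0 T hT.le t).2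
  have hwceq : ∀ t ∈ (Icc 0 T), wc t = w t := fun t ht => by
    simp only [hwc]; rw [projIcc_of_mem hT.le ht]
  obtain ⟨E, C, hC, hEb, hEm, hEi⟩ := exists_monotone_increment_bound S.ι M S.b hMs hM0 S.cb_pos
    S.b_elliptic (Λ := Λ1 + Λ2 + Λ3) hT hwcC (v' := iteratedDerivWithin (m + 1) p (Icc 0 T))
    (G := fun t => iteratedDerivWithin m g (Icc 0 T) t - iteratedDerivWithin (m + 1) φ (Icc 0 T) t)
    (fun t ht => (hasDerivWithinAt_iteratedDerivWithin hI hp hml ht).congr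
      (fun s hs => by rw [hwceq s hs]; exact hιw hs) (by rw [hwceq t ht]; exact hιw ht))
    (fun t ht q => by
      rw [hwceq t ht, hbw t ht, hyk t ht]
      simp only [hMdef, hA, add_apply, sub_apply, ContinuousLinearMap.comp_apply, dDual_apply,
        cDual_apply]
      ring)
    (fun t ht => (hL3 t ht).trans (by linarith))
    (fun s hs t ht => by
      have h1 := hL1 s hs t ht
      have h2 := hL2 s hs t ht
      have h3 : 0 ≤ Λ3 * |t - s| := by positivity
      have h4 := norm_sub_le (iteratedDerivWithin m g (Icc 0 T) t - iteratedDerivWithin m g (Icc 0 T) s)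
        (iteratedDerivWithin (m + 1) φ (Icc 0 T) t - iteratedDerivWithin (m + 1) φ (Icc 0 T) s)
      rw [sub_sub_sub_comm]
      linarith)
  -- increments of the top derivative
  have hinc : ∀ s ∈ (Icc 0 T), ∀ t ∈ (Icc 0 T), s ≤ t →
      ‖iteratedDerivWithin (m + 1) y (Icc 0 T) t - iteratedDerivWithin (m + 1) y (Icc 0 T) s‖ ^ 2
        ≤ (t - s) * ((2 * Λ1 ^ 2 * t + 2 * ‖S.b‖ ^ 2 * E t)
          - (2 * Λ1 ^ 2 * s + 2 * ‖S.b‖ ^ 2 * E s)) := by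
    intro s hs t ht hst
    have h1 := hL1 s hs t ht
    rw [abs_of_nonneg (sub_nonneg.2 hst)] at h1
    have h2 := hEi s hs t ht hst
    rw [hwceq t ht, hwceq s hs] at h2
    have e : iteratedDerivWithin (m + 1) y (Icc 0 T) t - iteratedDerivWithin (m + 1) y (Icc 0 T) s
        = (iteratedDerivWithin m g (Icc 0 T) t - iteratedDerivWithin m g (Icc 0 T) s) - S.b (w t - w s) := by
      rw [map_sub, hbw t ht, hbw s hs]; abel
    have h3 : ‖iteratedDerivWithin (m + 1) y (Icc 0 T) t - iteratedDerivWithin (m + 1) y (Icc 0 T) s‖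
        ≤ Λ1 * (t - s) + ‖S.b‖ * ‖w t - w s‖ := by
      rw [e]
      exact (norm_sub_le _ _).trans (add_le_add h1 (S.b.le_opNorm _))
    -- The Lipschitz part fits the same format, as `(t - s)²` is `t - s` times the increment of the
    -- identity; this is the linear term of the monotone function.
    calc _ ≤ (Λ1 * (t - s) + ‖S.b‖ * ‖w t - w s‖) ^ 2 := by gcongr
      _ ≤ 2 * Λ1 ^ 2 * (t - s) ^ 2 + 2 * ‖S.b‖ ^ 2 * ‖w t - w s‖ ^ 2 := by
          nlinarith [sq_nonneg (Λ1 * (t - s) - ‖S.b‖ * ‖w t - w s‖)]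
      _ ≤ 2 * Λ1 ^ 2 * (t - s) ^ 2 + 2 * ‖S.b‖ ^ 2 * ((t - s) * (E t - E s)) := by gcongr
      _ = _ := by ring
  have hbound : ∀ t ∈ (Icc 0 T), 0 ≤ 2 * Λ1 ^ 2 * t + 2 * ‖S.b‖ ^ 2 * E t ∧
      2 * Λ1 ^ 2 * t + 2 * ‖S.b‖ ^ 2 * E t ≤ 2 * Λ1 ^ 2 * T + 2 * ‖S.b‖ ^ 2 * C := by
    intro t ht
    have h1 := hEb t ht
    have h2 := mul_nonneg (sq_nonneg Λ1) ht.1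
    have h3 := mul_nonneg (sq_nonneg ‖S.b‖) h1.1
    have h4 := mul_le_mul_of_nonneg_left ht.2 (sq_nonneg Λ1)
    have h5 := mul_le_mul_of_nonneg_left h1.2 (sq_nonneg ‖S.b‖)
    exact ⟨by linarith, by linarith⟩
  have hmono : ∀ s ∈ (Icc 0 T), ∀ t ∈ (Icc 0 T), s ≤ t →
      2 * Λ1 ^ 2 * s + 2 * ‖S.b‖ ^ 2 * E s ≤ 2 * Λ1 ^ 2 * t + 2 * ‖S.b‖ ^ 2 * E t := by
    intro s hs t ht hst
    have h4 := mul_le_mul_of_nonneg_left hst (sq_nonneg Λ1)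
    have h5 := mul_le_mul_of_nonneg_left (hEm s hs t ht hst) (sq_nonneg ‖S.b‖)
    linarith
  exact ⟨fun t => 2 * Λ1 ^ 2 * t + 2 * ‖S.b‖ ^ 2 * E t, _, hbound, hmono, hinc⟩

/-- The exact solution at the time points, and the truncation error of the BDF-`k` operator along it,
measured in the dual of `Q`. -/
theorem IsSolution.exists_consistency [CompleteSpace V] [CompleteSpace Q]
    {S : EllipticParabolicData V Q H} {k : ℕ} (hk1 : 1 ≤ k) (hk5 : k ≤ 5)
    {T : ℝ} {f : ℝ → V →L[ℝ] ℝ} {g : ℝ → Q →L[ℝ] ℝ} {u : ℝ → V} {p : ℝ → H} (hT : 0 < T)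
    {R : (V →L[ℝ] ℝ) →L[ℝ] V} {D : H →L[ℝ] V} (hDa : ∀ h v, S.a (D h) v = S.d v h)
    (hDR : ∀ (f : V →L[ℝ] ℝ) (u : V) (p : H), (∀ v, S.a u v - S.d v p = f v) → u = D p + R f)
    (hf : ContDiffOn ℝ ((k + 1 : ℕ) : WithTop ℕ∞) f (Icc 0 T))
    (hg : ContDiffOn ℝ (k : WithTop ℕ∞) g (Icc 0 T))
    (hu : ContDiffOn ℝ (k : WithTop ℕ∞) u (Icc 0 T))
    (hp : ContDiffOn ℝ (k : WithTop ℕ∞) p (Icc 0 T)) (hs : S.IsSolution T f g u p) :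
    (∀ t ∈ Icc 0 T, ∀ v, S.a (u t) v - S.d v (p t) = f t v) ∧
    ∃ (pQ : ℝ → Q) (y θ : ℝ → Q →L[ℝ] ℝ) (B : ℝ), 0 ≤ B ∧
      (∀ t ∈ Icc 0 T, S.ι (pQ t) = p t) ∧
      (∀ t, y t = S.dDual (u t) + S.cDual (p t)) ∧
      (∀ t, S.b (pQ t) = g t - θ t) ∧
      ∀ (τ : ℝ) (N : ℕ), 0 < τ → N * τ ≤ T →
        τ * ∑ n ∈ Finset.Icc k N, ‖(1 / τ) • ∑ ℓ ∈ Finset.range (k + 1),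
          bdfCoeff k ℓ • y ((n - ℓ : ℕ) * τ) - θ (n * τ)‖ ^ 2 ≤ B * τ ^ (2 * k) := by
  obtain ⟨hell, pQ, hpQ, hι, hb⟩ := hs.forall_mem hk1 hT hf.continuousOn hg hu hp
  refine ⟨hell, pQ, ?_⟩
  generalize hydef : (fun s => S.dDual (u s) + S.cDual (p s)) = y at hb
  have hy : ∀ t, y t = S.dDual (u t) + S.cDual (p t) := fun t => by rw [← hydef]
  have hyC : ContDiffOn ℝ (k : WithTop ℕ∞) y (Icc 0 T) := by
    rw [← hydef]
    exact (hu.continuousLinearMap_comp S.dDual).add (hp.continuousLinearMap_comp S.cDual)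
  obtain ⟨m, rfl⟩ : ∃ m, k = m + 1 := ⟨k - 1, by omega⟩
  obtain ⟨F, C, hF, hmono, hinc⟩ := S.exists_increment_bound hT hDa hDR hf hg hp hell hpQ hι hy hyC hb
  obtain ⟨B, hB0, hB⟩ := exists_bdf_truncation_sum_le hk1 hk5 hT hyC hF hmono hinc
  exact ⟨y, derivWithin y (Icc 0 T), B, hB0, hι, hy, hb, hB⟩

/-! ### Residual and error equations of the stopped iteration. -/

theorem bdfIter_last {X : Type*} [AddCommGroup X] [Module ℝ X] {k n : ℕ} (hkn : k ≤ n) (τ : ℝ)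
    (y₀ : ℕ → X) (y : ℕ → ℕ → X) (J : ℕ → ℕ) :
    bdfIter k τ y₀ y J n (J n) =
      (1 / τ) • ∑ ℓ ∈ Finset.range (k + 1), bdfCoeff k ℓ • accepted k y₀ y J (n - ℓ) := by
  have h1 : Finset.Icc 1 k = Finset.Ico 1 (k + 1) := by ext; simp
  rw [bdfIter, h1, Finset.range_eq_Ico, Finset.sum_eq_sum_Ico_succ_bot (Nat.succ_pos k)]
  simp [accepted, not_lt.2 hkn]

/-- All inner iterates at one time level share the same history, which cancels. -/
theorem bdfIter_sub {X : Type*} [AddCommGroup X] [Module ℝ X] (k n i j : ℕ) (τ : ℝ)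
    (y₀ : ℕ → X) (y : ℕ → ℕ → X) (J : ℕ → ℕ) :
    bdfIter k τ y₀ y J n i - bdfIter k τ y₀ y J n j = (bdfCoeff k 0 / τ) • (y n i - y n j) := by
  rw [bdfIter, bdfIter, ← smul_sub, add_sub_add_right_eq_sub, ← smul_sub, smul_smul]
  congr 1
  ring

theorem IsFixedStressBDF.elliptic_accepted {S : EllipticParabolicData V Q H} {k : ℕ} {L τ tol : ℝ}
    {f : ℝ → V →L[ℝ] ℝ} {g : ℝ → Q →L[ℝ] ℝ} {N : ℕ} {u₀ : ℕ → V} {p₀ : ℕ → H}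
    {u : ℕ → ℕ → V} {p : ℕ → ℕ → H} {J : ℕ → ℕ}
    (h : S.IsFixedStressBDF k L τ tol f g N u₀ p₀ u p J) {n : ℕ} (hn : n ≤ N) (v : V) :
    S.a (accepted k u₀ u J n) v - S.d v (accepted k p₀ p J n) = f (n * τ) v := by
  unfold accepted
  split_ifs with hk
  · exact h.consistent n hk v
  · exact h.elliptic n (not_lt.1 hk) hn _ (h.termination n (not_lt.1 hk) hn).1.1 le_rfl v

/-- The perturbation of the BDF-`k` equation caused by stopping the inner iteration. -/
theorem IsFixedStressBDF.exists_perturbed_equation {S : EllipticParabolicData V Q H} {k : ℕ}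
    {L τ tol : ℝ} (hξ : 0 < bdfCoeff k 0) (hL : 0 < L) (hτ : 0 < τ) (htol : 0 < tol)
    {f : ℝ → V →L[ℝ] ℝ} {g : ℝ → Q →L[ℝ] ℝ} {N : ℕ} {u₀ : ℕ → V} {p₀ : ℕ → H}
    {u : ℕ → ℕ → V} {p : ℕ → ℕ → H} {J : ℕ → ℕ}
    (h : S.IsFixedStressBDF k L τ tol f g N u₀ p₀ u p J) {n : ℕ} (hkn : k ≤ n) (hn : n ≤ N) :
    ∃ (q : Q) (r : Q →L[ℝ] ℝ), S.ι q = accepted k p₀ p J n ∧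
      ‖r‖ ≤ bdfCoeff k 0 * (‖S.dDual‖ * Real.sqrt (2 / S.ca) + L * ‖S.ι‖ * Real.sqrt (1 / S.cc))
        * (tol / τ) ∧
      (1 / τ) • ∑ ℓ ∈ Finset.range (k + 1), bdfCoeff k ℓ •
        (S.dDual (accepted k u₀ u J (n - ℓ)) + S.cDual (accepted k p₀ p J (n - ℓ))) + S.b q
        = g (n * τ) + r := by
  obtain ⟨hJ1, δ, hδ, hcrit⟩ := (h.termination n hkn hn).1
  obtain ⟨q, hq, heq⟩ := h.parabolic n hkn hn (J n) hJ1 le_rfl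
  set ξ := bdfCoeff k 0 with hξdef
  set δu := u n (J n) - u n (J n - 1) with hδu
  set δp := p n (J n) - p n (J n - 1) with hδp
  have t1 : 0 ≤ S.ca / 2 * ‖δu‖ ^ 2 := mul_nonneg (by linarith [S.ca_pos]) (sq_nonneg _)
  have t2 : 0 ≤ S.cc * ‖δp‖ ^ 2 := mul_nonneg S.cc_pos.le (sq_nonneg _)
  have t3 : 0 ≤ L / 2 * ‖δp‖ ^ 2 := by positivity
  have t4 : 0 ≤ τ / ξ * S.cb * ‖δ‖ ^ 2 :=
    mul_nonneg (mul_nonneg (by positivity) S.cb_pos.le) (sq_nonneg _)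
  have hca := S.ca_pos
  have hcc := S.cc_pos
  have hu' : ‖δu‖ ≤ Real.sqrt (2 / S.ca) * tol := by
    refine le_of_sq_le_sq ?_ (by positivity)
    rw [mul_pow, Real.sq_sqrt (by positivity), div_mul_eq_mul_div, le_div_iff₀ hca]
    linarith
  have hp' : ‖δp‖ ≤ Real.sqrt (1 / S.cc) * tol := by
    refine le_of_sq_le_sq ?_ (by positivity)
    rw [mul_pow, Real.sq_sqrt (by positivity), div_mul_eq_mul_div, le_div_iff₀ hcc]
    linarith
  -- The first term comes from the lagged displacement in `d`, the second from the stabilization.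
  set r : Q →L[ℝ] ℝ := (ξ / τ) • (S.dDual δu - L • (innerSL ℝ δp).comp S.ι) with hr
  refine ⟨q, r, ?_, ?_, ?_⟩
  · rw [hq, accepted, if_neg (not_lt.2 hkn)]
  · have h1 : ‖S.dDual δu‖ ≤ ‖S.dDual‖ * (Real.sqrt (2 / S.ca) * tol) :=
      (S.dDual.le_opNorm _).trans (by gcongr)
    have h2 : ‖L • (innerSL ℝ δp).comp S.ι‖ ≤ L * (Real.sqrt (1 / S.cc) * tol * ‖S.ι‖) := by
      rw [norm_smul, Real.norm_of_nonneg hL.le]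
      gcongr
      refine (ContinuousLinearMap.opNorm_comp_le _ _).trans ?_
      rw [innerSL_apply_norm]
      gcongr
    rw [hr, norm_smul, Real.norm_of_nonneg (by positivity)]
    calc ξ / τ * ‖S.dDual δu - L • (innerSL ℝ δp).comp S.ι‖
        ≤ ξ / τ * (‖S.dDual‖ * (Real.sqrt (2 / S.ca) * tol)
          + L * (Real.sqrt (1 / S.cc) * tol * ‖S.ι‖)) := by
          gcongr
          exact (norm_sub_le _ _).trans (add_le_add h1 h2)
      _ = _ := by ring
  · ext z
    have h1 := heq z
    have e1 : bdfIter k τ u₀ u J n (J n - 1) = bdfIter k τ u₀ u J n (J n) - (ξ / τ) • δu := by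
      rw [← bdfIter_sub k n (J n) (J n - 1) τ u₀ u J]; abel
    rw [e1, bdfIter_sub, bdfIter_last hkn, bdfIter_last hkn] at h1
    simp only [hr, map_sub, map_smul, map_sum, sub_apply, smul_apply, add_apply, sum_apply,
      smul_eq_mul, smul_add, Finset.sum_add_distrib, dDual_apply, cDual_apply,
      ContinuousLinearMap.comp_apply, innerSL_apply_apply, real_inner_smul_left] at h1 ⊢
    linarith

/-- The equation satisfied by the errors at the time points. -/
theorem IsFixedStressBDF.exists_error_equation {S : EllipticParabolicData V Q H} {k : ℕ}
    {L τ tol : ℝ} (hξ : 0 < bdfCoeff k 0) (hL : 0 < L) (hτ : 0 < τ) (htol : 0 < tol)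
    {D : H →L[ℝ] V} {f : ℝ → V →L[ℝ] ℝ} {g : ℝ → Q →L[ℝ] ℝ} {N : ℕ} {u₀ : ℕ → V} {p₀ : ℕ → H}
    {un : ℕ → ℕ → V} {pn : ℕ → ℕ → H} {J : ℕ → ℕ}
    (h : S.IsFixedStressBDF k L τ tol f g N u₀ p₀ un pn J)
    {u : ℝ → V} {p : ℝ → H} {pQ : ℝ → Q} {y θ : ℝ → Q →L[ℝ] ℝ}
    (heu : ∀ n ≤ N, accepted k u₀ un J n - u (n * τ) = D (accepted k p₀ pn J n - p (n * τ)))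
    (hι : ∀ n ≤ N, S.ι (pQ (n * τ)) = p (n * τ))
    (hy : ∀ t, y t = S.dDual (u t) + S.cDual (p t)) (hb : ∀ t, S.b (pQ t) = g t - θ t)
    {n : ℕ} (hkn : k ≤ n) (hn : n ≤ N) :
    ∃ (q : Q) (r : Q →L[ℝ] ℝ), S.ι q = accepted k p₀ pn J n - p (n * τ) ∧
      ‖r‖ ≤ bdfCoeff k 0 * (‖S.dDual‖ * Real.sqrt (2 / S.ca) + L * ‖S.ι‖ * Real.sqrt (1 / S.cc))
        * (tol / τ) ∧
      ∀ z, 1 / τ * (S.c + S.d.comp D) (∑ ℓ ∈ Finset.range (k + 1), bdfCoeff k ℓ •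
          (accepted k p₀ pn J (n - ℓ) - p ((n - ℓ : ℕ) * τ))) (S.ι z) + S.b q z
        = (r - ((1 / τ) • ∑ ℓ ∈ Finset.range (k + 1), bdfCoeff k ℓ • y ((n - ℓ : ℕ) * τ)
          - θ (n * τ))) z := by
  obtain ⟨q, r, hq, hr, heq⟩ := h.exists_perturbed_equation hξ hL hτ htol hkn hn
  refine ⟨q - pQ (n * τ), r, by rw [map_sub, hq, hι n hn], hr, fun z => ?_⟩
  -- The relation `e_u = D e_p` is needed at every index of the stencil, including starting indices;
  -- there it rests on their consistency.
  have hterm : ∀ ℓ, (S.c + S.d.comp D) (accepted k p₀ pn J (n - ℓ) - p ((n - ℓ : ℕ) * τ)) (S.ι z)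
      = (S.dDual (accepted k u₀ un J (n - ℓ)) + S.cDual (accepted k p₀ pn J (n - ℓ))) z
        - y ((n - ℓ : ℕ) * τ) z := by
    intro ℓ
    have h1 := heu (n - ℓ) (by omega)
    rw [add_apply, add_apply, ContinuousLinearMap.comp_apply, ← h1, hy]
    simp only [map_sub, sub_apply, add_apply, dDual_apply, cDual_apply]
    ring
  have h1 := congrArg (fun A => A z) heq
  simp only [add_apply, smul_apply, sum_apply, smul_eq_mul] at h1
  simp only [map_sum, map_smul, sum_apply, smul_apply, hterm]
  simp only [map_sub, hb, sub_apply, add_apply, smul_apply, sum_apply, smul_eq_mul, mul_sub,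
    Finset.sum_sub_distrib]
  linarith

end EllipticParabolicData

/-! ### Assembly of the error estimate. -/

theorem theorem3p2 {V Q H : Type*}
    [NormedAddCommGroup V] [InnerProductSpace ℝ V] [CompleteSpace V]
    [NormedAddCommGroup Q] [InnerProductSpace ℝ Q] [CompleteSpace Q]
    [NormedAddCommGroup H] [InnerProductSpace ℝ H] [CompleteSpace H]
    (S : EllipticParabolicData V Q H) (k : ℕ) (hk1 : 1 ≤ k) (hk5 : k ≤ 5)
    (L : ℝ) (hL : 0 < L) :
    ∃ C > (0 : ℝ), ∃ K > (0 : ℝ),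
      ∀ (T : ℝ) (f : ℝ → V →L[ℝ] ℝ) (g : ℝ → Q →L[ℝ] ℝ) (u : ℝ → V) (p : ℝ → H),
        0 < T →
        ContDiffOn ℝ ((k + 1 : ℕ) : WithTop ℕ∞) f (Icc 0 T) →
        ContDiffOn ℝ (k : WithTop ℕ∞) g (Icc 0 T) →
        ContDiffOn ℝ (k : WithTop ℕ∞) u (Icc 0 T) →
        ContDiffOn ℝ (k : WithTop ℕ∞) p (Icc 0 T) →
        S.IsSolution T f g u p →
        ∃ R > (0 : ℝ),
          ∀ (τ tol : ℝ) (N : ℕ) (u₀ : ℕ → V) (p₀ : ℕ → H)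
            (un : ℕ → ℕ → V) (pn : ℕ → ℕ → H) (J : ℕ → ℕ),
            0 < τ → 0 < tol → N * τ ≤ T →
            S.IsFixedStressBDF k L τ tol f g N u₀ p₀ un pn J →
            ∀ n : ℕ, k ≤ n → n ≤ N →
              ‖un n (J n) - u (n * τ)‖ ^ 2 + ‖pn n (J n) - p (n * τ)‖ ^ 2
                ≤ Real.exp (C * (n * τ)) *
                  (K * (tol ^ 2 / τ ^ 3) + R * τ ^ (2 * k)
                    + K * ∑ ℓ ∈ Finset.range k, ‖p₀ ℓ - p (ℓ * τ)‖ ^ 2) := by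
  have hξ := bdfCoeff_zero_pos hk1 hk5
  obtain ⟨A, D, hDa, hDR⟩ := S.exists_elliptic_solution
  obtain ⟨hMs, hMe⟩ := S.reduced_form_properties hDa
  obtain ⟨K₀, hK₀, hstab⟩ := bdf_stability S.ι (S.c + S.d.comp D) S.b hMs S.b_symm S.cb_pos S.cc_pos
    hMe S.b_elliptic hk1 hk5
  set κ := bdfCoeff k 0 * (‖S.dDual‖ * Real.sqrt (2 / S.ca) + L * ‖S.ι‖ * Real.sqrt (1 / S.cc))
    with hκ
  set P := (‖D‖ ^ 2 + 1) * K₀ with hP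
  have hP0 : 0 < P := by positivity
  -- `P` combines the stability constant with `‖D e‖² + ‖e‖² ≤ (‖D‖² + 1) ‖e‖²`; the rate `2` is
  -- that of `(tⁿ)² ≤ exp (2 tⁿ)`.
  refine ⟨2, two_pos, P * (1 + 2 * κ ^ 2), by positivity, ?_⟩
  intro T f g u p hT hf hg hu hp hs
  obtain ⟨hell, pQ, y, θ, B, hB0, hι, hy, hb, hB⟩ :=
    hs.exists_consistency hk1 hk5 hT hDa hDR hf hg hu hp
  refine ⟨2 * P * B + 1, by positivity, ?_⟩
  intro τ tol N u₀ p₀ un pn J hτ htol hN hrun n hkn hnN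
  have hmem : ∀ m : ℕ, m ≤ N → (m : ℝ) * τ ∈ Icc 0 T := fun m hm =>
    ⟨by positivity, le_trans (by gcongr) hN⟩
  have heu : ∀ m ≤ N, accepted k u₀ un J m - u (m * τ)
      = D (accepted k p₀ pn J m - p (m * τ)) := by
    intro m hm
    rw [hDR _ _ _ (hrun.elliptic_accepted hm), hDR _ _ _ (hell _ (hmem m hm)), map_sub]
    abel
  choose! eQ r hQ hr heq using fun m (hkm : k ≤ m) (hm : m ≤ N) =>
    hrun.exists_error_equation hξ hL hτ htol heu (fun m hm => hι _ (hmem m hm)) hy hb hkm hm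
  set tr : ℕ → Q →L[ℝ] ℝ := fun m => (1 / τ) • ∑ ℓ ∈ Finset.range (k + 1),
    bdfCoeff k ℓ • y ((m - ℓ : ℕ) * τ) - θ (m * τ) with htr
  have hs1 := hstab τ N (fun m => accepted k p₀ pn J m - p (m * τ)) eQ (fun m => r m - tr m) hτ
    hQ heq n hkn hnN
  have hB' := hB τ n hτ ((by gcongr : (n : ℝ) * τ ≤ N * τ).trans hN)
  have hsum : τ * ∑ m ∈ Finset.Icc k n, ‖r m - tr m‖ ^ 2 ≤
      2 * κ ^ 2 * ((n * τ) ^ 2 * (tol ^ 2 / τ ^ 3)) + 2 * (B * τ ^ (2 * k)) := by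
    have h1 : ∀ m ∈ Finset.Icc k n, ‖r m - tr m‖ ^ 2 ≤ 2 * (κ * (tol / τ)) ^ 2 + 2 * ‖tr m‖ ^ 2 := by
      intro m hm
      obtain ⟨hkm, hmn⟩ := Finset.mem_Icc.1 hm
      have h2 := hr m hkm (hmn.trans hnN)
      have h3 := norm_sub_le (r m) (tr m)
      calc ‖r m - tr m‖ ^ 2 ≤ (κ * (tol / τ) + ‖tr m‖) ^ 2 := by gcongr; linarith
        _ ≤ _ := by nlinarith [sq_nonneg (κ * (tol / τ) - ‖tr m‖)]
    have h2 := Finset.sum_le_sum h1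
    rw [Finset.sum_add_distrib, Finset.sum_const, nsmul_eq_mul, ← Finset.mul_sum, Nat.card_Icc] at h2
    -- Bounding the number of steps by `n²` rather than `n` trades a factor `1/τ` for `tⁿ`,
    -- producing `(tⁿ)² tol²/τ³`.
    have h3 : ((n + 1 - k : ℕ) : ℝ) ≤ n ^ 2 := by
      have : n + 1 - k ≤ n ^ 2 := by
        have : n ≤ n ^ 2 := Nat.le_self_pow two_ne_zero n
        omega
      exact_mod_cast this
    have h4 : ((n + 1 - k : ℕ) : ℝ) * (2 * (κ * (tol / τ)) ^ 2) ≤ n ^ 2 * (2 * (κ * (tol / τ)) ^ 2) := by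
      gcongr
    have h5 := mul_le_mul_of_nonneg_left (h2.trans (add_le_add_left h4 _)) hτ.le
    refine h5.trans ?_
    have h6 : τ * (n ^ 2 * (2 * (κ * (tol / τ)) ^ 2))
        = 2 * κ ^ 2 * ((n * τ) ^ 2 * (tol ^ 2 / τ ^ 3)) := by field_simp
    rw [mul_add, h6]
    linarith
  have hstart : ∑ ℓ ∈ Finset.range k, ‖accepted k p₀ pn J ℓ - p (ℓ * τ)‖ ^ 2
      = ∑ ℓ ∈ Finset.range k, ‖p₀ ℓ - p (ℓ * τ)‖ ^ 2 := by
    refine Finset.sum_congr rfl fun ℓ hℓ => ?_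
    rw [accepted, if_pos (Finset.mem_range.1 hℓ)]
  have hu1 := heu n hnN
  simp only [accepted, if_neg (not_lt.2 hkn)] at hu1
  simp only [hstart] at hs1
  simp only [accepted, if_neg (not_lt.2 hkn)] at hs1
  rw [hu1]
  set e := pn n (J n) - p (n * τ) with he
  set Z := ∑ ℓ ∈ Finset.range k, ‖p₀ ℓ - p (ℓ * τ)‖ ^ 2 with hZ
  have hZ0 : 0 ≤ Z := Finset.sum_nonneg fun _ _ => sq_nonneg _
  have hD : ‖D e‖ ^ 2 ≤ ‖D‖ ^ 2 * ‖e‖ ^ 2 := by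
    rw [← mul_pow]; gcongr; exact D.le_opNorm e
  have hn0 : 0 ≤ (n : ℝ) * τ := by positivity
  have hexp1 : 1 ≤ Real.exp (2 * (n * τ)) := Real.one_le_exp (by positivity)
  have hexp2 : ((n : ℝ) * τ) ^ 2 ≤ Real.exp (2 * (n * τ)) := by
    have h1 : (n : ℝ) * τ ≤ Real.exp (n * τ) := by linarith [Real.add_one_le_exp ((n : ℝ) * τ)]
    calc ((n : ℝ) * τ) ^ 2 ≤ Real.exp (n * τ) ^ 2 := by gcongr
      _ = _ := by rw [← Real.exp_nat_mul]; norm_num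
  set X := Real.exp (2 * (n * τ)) with hX
  set δ := tol ^ 2 / τ ^ 3 with hδ
  have hδ0 : 0 ≤ δ := by positivity
  have hτk : 0 ≤ τ ^ (2 * k) := by positivity
  calc ‖D e‖ ^ 2 + ‖e‖ ^ 2 ≤ (‖D‖ ^ 2 + 1) * ‖e‖ ^ 2 := by linarith
    _ ≤ (‖D‖ ^ 2 + 1) * (K₀ * (Z + (2 * κ ^ 2 * ((n * τ) ^ 2 * δ) + 2 * (B * τ ^ (2 * k))))) := by
        gcongr
        exact hs1.trans (by gcongr)
    _ = P * (2 * κ ^ 2) * (((n * τ) ^ 2) * δ) + (2 * P * B) * τ ^ (2 * k) * 1 + P * Z * 1 := by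
        rw [hP]; ring
    _ ≤ P * (1 + 2 * κ ^ 2) * (X * δ) + (2 * P * B + 1) * τ ^ (2 * k) * X
          + P * (1 + 2 * κ ^ 2) * Z * X := by
        have : 0 ≤ 2 * κ ^ 2 := by positivity
        have : P * Z ≤ P * (1 + 2 * κ ^ 2) * Z := by
          gcongr; exact le_mul_of_one_le_right hP0.le (by linarith)
        gcongr
        · linarith
        · linarith
    _ = _ := by ring
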